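/- **Setting.** For $\alpha\in(0,1)$ let $S(\alpha,1,1)$ be the maximally skewed $\alpha$-stable law with characteristic function $\lambda\mapsto\exp\left(-|\lambda|^\alpha\left(1-\mathrm{sign}(\lambda)\sqrt{-1}\,\tan\frac{\pi\alpha}{2}\right)\right)$, and for $S_1,S_2\sim S(\alpha,1,1)$ independent put $F_\alpha(t)=\Pr\left((S_2/S_1)^{\alpha/(1-\alpha)}\le t\right)$, $t\ge 0$. Let $x\in\mathbb{R}^N$ be a nonzero signal with $x_i\ge 0$ for all $i$, and let $\theta=\left(\sum_{i=1}^N x_i^\alpha\right)^{1/\alpha}$. Take $M\ge 1$ measurements $y_j=\sum_{i=1}^N x_i s_{ij}$, $1\le j\le M$, where the $s_{ij}\sim S(\alpha,1,1)$ are i.i.d., and estimate $x_i$ by $\hat x_{i}=\min_{1\le j\le M} y_j/s_{ij}$. Let $\epsilon>0$ and $\delta>0$. **Theorem.** There are constants $C_\alpha>0$ and functions $\eta_\alpha$ $(0<\alpha\le 1/2)$, depending on nothing but $\alpha$, with $\eta_\alpha(r)\to 0$ as $r\to 0+$ for each fixed $\alpha$, such that the following holds. The constant $C_\alpha$ is the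 one in $F_\alpha(t)=t^{1-\alpha}/(C_\alpha+o(1))$, $t\to 0+$, that is, $C_\alpha=\lim_{t\to 0+}t^{1-\alpha}/F_\alpha(t)$; moreover $C_{1/2}=\pi/2$ and $C_\alpha\to 1$ as $\alpha\to 0+$. In order that $$\sum_{i=1}^N \Pr\left(\hat x_i-x_i\ge\epsilon\right)\le\delta,$$ each of the following conditions is sufficient: 1. $\alpha\in(0,1)$ and $\displaystyle M\ge\frac{\log (N/\delta)}{-\log\left[1-F_\alpha\left((\epsilon/\theta)^{\alpha/(1-\alpha)}\right)\right]}$; 2. $\alpha\in(0,1)$, $\epsilon/\theta<1$ and $\displaystyle M\ge\frac{\log (N/\delta)}{\log\left[1+(\epsilon/\theta)^{\alpha/(1-\alpha)}\right]}$; 3. $\alpha\in(0,1/2]$, $\epsilon/\theta<\alpha$ and $\displaystyle M\ge\left(C_\alpha+\eta_\alpha(\epsilon/\theta)\right)\left(\frac{\theta}{\epsilon}\right)^{\alpha}\log (N/\delta)$; 4. $\alpha=1/2$, $\epsilon/\theta<1$ and $\displaystyle M\ge\frac{\pi}{2}\sqrt{\frac{\theta}{\epsilon}}\,\log (N/\delta)$.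 The second bound is sharp as $\alpha\to 0$ and the third is sharp as $\epsilon/\theta\to 0$, in the sense that they are asymptotically equivalent to the first: for fixed $x$ and $\epsilon$, $$\frac{1/\log\left[1+(\epsilon/\theta)^{\alpha/(1-\alpha)}\right]}{1/\left(-\log\left[1-F_\alpha\left((\epsilon/\theta)^{\alpha/(1-\alpha)}\right)\right]\right)}\to 1\quad(\alpha\to 0+),$$ and for fixed $\alpha\in(0,1/2]$, $$\frac{C_\alpha\, r^{-\alpha}}{1/\left(-\log\left[1-F_\alpha\left(r^{\alpha/(1-\alpha)}\right)\right]\right)}\to 1\quad(r\to 0+).$$ -/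

import Mathlib

open MeasureTheory ProbabilityTheory Set Filter Topology

noncomputable section

/-- `μ` is the maximally skewed `α`-stable law `S(α,1,1)` (skewness `1`, scale `1`, `α ≠ 1`): the
probability measure on `ℝ` with characteristic function
`u ↦ exp (-|u|^α (1 - i sign(u) tan(π α / 2)))`. -/
def IsMaxSkewedStable (α : ℝ) (μ : Measure ℝ) : Prop :=
  IsProbabilityMeasure μ ∧
    ∀ u : ℝ, charFun μ u =
      Complex.exp (-((|u| ^ α : ℝ) : ℂ) *
        (1 - (Real.sign u : ℂ) * Complex.I * ((Real.tan (Real.pi * α / 2) : ℝ) : ℂ)))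

/-- `F_α(t) = Pr((S₂ / S₁)^(α/(1-α)) ≤ t)` for `S₁, S₂` independent with common law `μ`. -/
def ratioCDF (α : ℝ) (μ : Measure ℝ) (t : ℝ) : ℝ :=
  (μ.prod μ).real {p : ℝ × ℝ | (p.2 / p.1) ^ (α / (1 - α)) ≤ t}

/-- `θ = (∑ i, x_i^α)^(1/α)`. -/
def signalScale (α : ℝ) {N : ℕ} (x : Fin N → ℝ) : ℝ :=
  (∑ i, x i ^ α) ^ (1 / α)

/-- The measurement `y_j = ∑ i, x_i s_ij`. -/
def measurement {N M : ℕ} (x : Fin N → ℝ) (s : Fin N → Fin M → ℝ) (j : Fin M) : ℝ :=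
  ∑ i, x i * s i j

/-- The minimum estimator `x̂_i = min_j y_j / s_ij` (for `M ≥ 1` the infimum over the finite
nonempty index set is a minimum). -/
def minEstimator {N M : ℕ} (x : Fin N → ℝ) (s : Fin N → Fin M → ℝ) (i : Fin N) : ℝ :=
  ⨅ j : Fin M, measurement x s j / s i j

end

/-! The variables `s i j` are almost surely positive, so `x̂_i - x_i ≥ ε` forces, for every `j`, the
combination of column `j` with coefficients `x`, except `-ε` in place `i`, to be nonnegative. Such a
combination is again strictly stable, with characteristic function `exp (-(a - i b) u ^ α)` for `u >
0`, and inversion at the origin gives its sign probabilities in closed form: it is negative with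
probability `1/2 - arctan (b / a) / (π α)` (`stable_measureReal_Iio`). The same formula gives the
positivity of `S(α,1,1)` and identifies `F_α(t)` with `L(t ^ (1 - α))`, where `L = lampertiCDF α`.

With `r = ε / θ`, one column errs with probability at most `1 - L(r ^ α)`. Columns are independent,
so the `N` errors sum to at most `N (1 - L(r ^ α)) ^ M`. It remains to find `κ` with `1 - L(r ^ α) ≤
exp (-κ)` and `log (N / δ) ≤ M κ`. The first condition takes equality; the others rest on `L(t ^ (1
- α)) ≥ t / (1 + t)` for `t ≤ 1`, on `L(u) ≥ k u / (1 + u)` with `k = L'(0) = sin (π α) / (π α) = 1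
/ C α`, and, for `α = 1/2`, on `1 - L(u) ≤ exp (-2 u / π)` for `u ≤ 1`. Sharpness comes from the
derivative of `L` at `0` and from the limit of `L` as `α → 0`. -/

/-! ### Fourier inversion at the origin. -/

theorem integrableOn_exp_neg_mul_Ioi {a : ℝ} (ha : 0 < a) :
    IntegrableOn (fun u : ℝ => Real.exp (-a * u)) (Ioi 0) :=
  exp_neg_integrableOn_Ioi 0 ha

theorem integral_exp_neg_mul_cos {a : ℝ} (ha : 0 < a) (x : ℝ) :
    ∫ u in Ioi (0 : ℝ), Real.exp (-a * u) * Real.cos (u * x) = a / (a ^ 2 + x ^ 2) := by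
  have hre : ((-a : ℂ) + x * Complex.I).re < 0 := by simpa using ha
  have h := integral_exp_mul_complex_Ioi hre 0
  have h2 := congrArg Complex.re h
  have hint := integrableOn_exp_mul_complex_Ioi hre 0
  rw [← RCLike.re_eq_complex_re, ← integral_re hint] at h2
  have hne : a ^ 2 + x ^ 2 ≠ 0 := by positivity
  convert h2 using 1
  · refine setIntegral_congr_fun measurableSet_Ioi fun u _ => ?_
    simp [Complex.exp_re, mul_comm]
  · simp [Complex.div_re, Complex.normSq_apply]
    field_simp

theorem abs_sin_mul_div_le (u x : ℝ) : |Real.sin (u * x) / u| ≤ |x| := by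
  rcases eq_or_ne u 0 with rfl | hu
  · simp
  · rw [abs_div, div_le_iff₀ (abs_pos.2 hu), ← abs_mul, mul_comm x u]
    exact Real.abs_sin_le_abs

theorem integrableOn_exp_neg_mul_sin_div {a : ℝ} (ha : 0 < a) (x : ℝ) :
    IntegrableOn (fun u : ℝ => Real.exp (-a * u) * (Real.sin (u * x) / u)) (Ioi 0) := by
  refine ((integrableOn_exp_neg_mul_Ioi ha).mul_const |x|).mono'
    (by fun_prop) (ae_of_all _ fun u => ?_)
  rw [Real.norm_eq_abs, abs_mul, abs_of_pos (Real.exp_pos _)]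
  exact mul_le_mul_of_nonneg_left (abs_sin_mul_div_le u x) (Real.exp_pos _).le

/-- Differentiating in `x` under the integral removes the `1 / u` and leaves the Laplace transform
of the cosine; both sides vanish at `x = 0`. -/
theorem integral_exp_neg_mul_sin_div {a : ℝ} (ha : 0 < a) (x : ℝ) :
    ∫ u in Ioi (0 : ℝ), Real.exp (-a * u) * (Real.sin (u * x) / u) = Real.arctan (x / a) := by
  set f : ℝ → ℝ := fun x => ∫ u in Ioi (0 : ℝ), Real.exp (-a * u) * (Real.sin (u * x) / u) with hf
  have hd : ∀ y, HasDerivAt f (a / (a ^ 2 + y ^ 2)) y := by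
    intro y
    rw [← integral_exp_neg_mul_cos ha y]
    refine (hasDerivAt_integral_of_dominated_loc_of_deriv_le
      (μ := volume.restrict (Ioi (0 : ℝ))) (s := univ)
      (F' := fun z u => Real.exp (-a * u) * Real.cos (u * z))
      (bound := fun u => Real.exp (-a * u)) univ_mem
      (Eventually.of_forall fun z => (integrableOn_exp_neg_mul_sin_div ha z).aestronglyMeasurable)
      (integrableOn_exp_neg_mul_sin_div ha y) (by fun_prop)
      (ae_of_all _ fun u z _ => ?_) (integrableOn_exp_neg_mul_Ioi ha)
      ((ae_restrict_mem measurableSet_Ioi).mono fun u hu z _ => ?_)).2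
    · rw [Real.norm_eq_abs, abs_mul, abs_of_pos (Real.exp_pos _)]
      exact mul_le_of_le_one_right (Real.exp_pos _).le (Real.abs_cos_le_one _)
    · have hu0 : u ≠ 0 := (mem_Ioi.1 hu).ne'
      have h1 : HasDerivAt (fun z : ℝ => u * z) u z := by
        simpa using (hasDerivAt_id z).const_mul u
      convert! (((Real.hasDerivAt_sin (u * z)).comp z h1).div_const u).const_mul
        (Real.exp (-a * u)) using 1
      field_simp
  have hd2 : ∀ y, HasDerivAt (fun y => Real.arctan (y / a)) (a / (a ^ 2 + y ^ 2)) y := by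
    intro y
    convert! (Real.hasDerivAt_arctan (y / a)).comp y ((hasDerivAt_id y).div_const a) using 1
    have : a ^ 2 + y ^ 2 ≠ 0 := by positivity
    field_simp
  have hc : ∀ y, HasDerivAt (fun y => f y - Real.arctan (y / a)) 0 y := fun y => by
    simpa only [sub_self] using! (hd y).sub (hd2 y)
  have h := is_const_of_deriv_eq_zero (fun y => (hc y).differentiableAt) (fun y => (hc y).deriv) x 0
  have h0 : f 0 = 0 := by simp [hf]
  simp only [h0, zero_div, Real.arctan_zero, sub_zero] at h
  exact sub_eq_zero.1 h

theorem charFun_im {ν : Measure ℝ} [IsFiniteMeasure ν] (u : ℝ) :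
    (charFun ν u).im = ∫ x, Real.sin (u * x) ∂ν := by
  rw [charFun_apply_real]
  have hint : Integrable (fun x : ℝ => Complex.exp (u * x * Complex.I)) ν := by
    refine (integrable_const (1 : ℝ)).mono' (by fun_prop) (ae_of_all _ fun x => ?_)
    rw [← Complex.ofReal_mul, Complex.norm_exp_ofReal_mul_I]
  rw [← RCLike.im_eq_complex_im, ← integral_im hint]
  refine integral_congr_ae (ae_of_all _ fun x => ?_)
  simp only [← Complex.ofReal_mul, RCLike.im_eq_complex_im, Complex.exp_ofReal_mul_I_im]

theorem charFun_re {ν : Measure ℝ} [IsFiniteMeasure ν] (u : ℝ) :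
    (charFun ν u).re = ∫ x, Real.cos (u * x) ∂ν := by
  rw [charFun_apply_real]
  have hint : Integrable (fun x : ℝ => Complex.exp (u * x * Complex.I)) ν := by
    refine (integrable_const (1 : ℝ)).mono' (by fun_prop) (ae_of_all _ fun x => ?_)
    rw [← Complex.ofReal_mul, Complex.norm_exp_ofReal_mul_I]
  rw [← RCLike.re_eq_complex_re, ← integral_re hint]
  refine integral_congr_ae (ae_of_all _ fun x => ?_)
  simp only [← Complex.ofReal_mul, RCLike.re_eq_complex_re, Complex.exp_ofReal_mul_I_re]

theorem abs_exp_sub_exp_div_le {a b u : ℝ} (hab : a ≤ b) (hu : 0 < u) :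
    |(Real.exp (-a * u) - Real.exp (-b * u)) / u| ≤ (b - a) * Real.exp (-a * u) := by
  have h1 : Real.exp (-b * u) ≤ Real.exp (-a * u) :=
    Real.exp_le_exp.2 (by nlinarith)
  rw [abs_of_nonneg (div_nonneg (sub_nonneg.2 h1) hu.le), div_le_iff₀ hu]
  have h2 : Real.exp (-b * u) = Real.exp (-a * u) * Real.exp (-(b - a) * u) := by
    rw [← Real.exp_add]; ring_nf
  have h3 := Real.add_one_le_exp (-(b - a) * u)
  rw [h2]
  nlinarith [Real.exp_pos (-a * u)]

/-- Fubini. Taking a difference of two arctangents makes the weight `(exp (-a u) - exp (-b u)) / u`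
integrable at `0`, so nothing is asked of `ν`; as `a → 0` and `b → ∞` the left integrand becomes `π
/ 2` times the sign. -/
theorem integral_arctan_sub_arctan {ν : Measure ℝ} [IsProbabilityMeasure ν] {a b : ℝ}
    (ha : 0 < a) (hab : a ≤ b) :
    ∫ x, (Real.arctan (x / a) - Real.arctan (x / b)) ∂ν =
      ∫ u in Ioi (0 : ℝ), (Real.exp (-a * u) - Real.exp (-b * u)) * ((charFun ν u).im / u) := by
  have hb : 0 < b := ha.trans_le hab
  have hw : Integrable (fun u : ℝ => (Real.exp (-a * u) - Real.exp (-b * u)) / u)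
      (volume.restrict (Ioi 0)) := by
    refine ((integrableOn_exp_neg_mul_Ioi ha).const_mul (b - a)).mono'
      (by fun_prop : Measurable _).aestronglyMeasurable ?_
    exact (ae_restrict_mem measurableSet_Ioi).mono fun u hu => abs_exp_sub_exp_div_le hab hu
  have hF : Integrable (fun p : ℝ × ℝ => (Real.exp (-a * p.2) - Real.exp (-b * p.2)) / p.2 *
      Real.sin (p.2 * p.1)) (ν.prod (volume.restrict (Ioi 0))) := by
    refine ((hw.comp_snd ν).norm).mono' (by fun_prop) (ae_of_all _ fun p => ?_)
    rw [norm_mul]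
    exact mul_le_of_le_one_right (norm_nonneg _) (Real.abs_sin_le_one _)
  have hl : ∀ x, Real.arctan (x / a) - Real.arctan (x / b) = ∫ u in Ioi (0 : ℝ),
      (Real.exp (-a * u) - Real.exp (-b * u)) / u * Real.sin (u * x) := by
    intro x
    rw [← integral_exp_neg_mul_sin_div ha, ← integral_exp_neg_mul_sin_div hb,
      ← integral_sub (integrableOn_exp_neg_mul_sin_div ha x)
        (integrableOn_exp_neg_mul_sin_div hb x)]
    refine integral_congr_ae (ae_of_all _ fun u => ?_)
    simp only
    ring
  simp_rw [hl]
  rw [integral_integral_swap hF]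
  refine integral_congr_ae (ae_of_all _ fun u => ?_)
  simp only [charFun_im]
  rw [integral_const_mul]
  ring

theorem tendsto_arctan_sub_arctan (x : ℝ) :
    Tendsto (fun c : ℝ => Real.arctan (x / c⁻¹) - Real.arctan (x / c)) atTop
      (𝓝 (Real.pi / 2 * Real.sign x)) := by
  have h0 : Tendsto (fun c : ℝ => Real.arctan (x / c)) atTop (𝓝 0) := by
    have := (Real.continuous_arctan.tendsto 0).comp
      ((tendsto_const_nhds (x := x)).div_atTop tendsto_id)
    simpa [Function.comp_def] using this
  have htop := Real.tendsto_arctan_atTop.mono_right nhdsWithin_le_nhds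
  have hbot := Real.tendsto_arctan_atBot.mono_right nhdsWithin_le_nhds
  have h1 : Tendsto (fun c : ℝ => Real.arctan (x / c⁻¹)) atTop
      (𝓝 (Real.pi / 2 * Real.sign x)) := by
    simp only [div_inv_eq_mul]
    rcases lt_trichotomy x 0 with hx | rfl | hx
    · rw [Real.sign_of_neg hx, mul_neg_one]
      have := hbot.comp (tendsto_id.const_mul_atTop_of_neg hx)
      exact this
    · simp
    · rw [Real.sign_of_pos hx, mul_one]
      exact htop.comp (tendsto_id.const_mul_atTop hx)
  simpa using h1.sub h0

/-- Inversion formula at the origin, for laws whose characteristic function has an imaginary part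
integrable against `du / u`. -/
theorem integral_sign_eq {ν : Measure ℝ} [IsProbabilityMeasure ν]
    (hψ : IntegrableOn (fun u : ℝ => (charFun ν u).im / u) (Ioi 0)) :
    Real.pi / 2 * ∫ x, Real.sign x ∂ν = ∫ u in Ioi (0 : ℝ), (charFun ν u).im / u := by
  have h1 : Tendsto (fun c : ℝ => ∫ x, (Real.arctan (x / c⁻¹) - Real.arctan (x / c)) ∂ν) atTop
      (𝓝 (∫ x, Real.pi / 2 * Real.sign x ∂ν)) := by
    refine tendsto_integral_filter_of_dominated_convergence (fun _ => Real.pi)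
      (Eventually.of_forall fun c => by fun_prop)
      (Eventually.of_forall fun c => ae_of_all _ fun x => ?_) (integrable_const _)
      (ae_of_all _ tendsto_arctan_sub_arctan)
    rw [Real.norm_eq_abs, abs_le]
    have := Real.arctan_lt_pi_div_two (x / c⁻¹)
    have := Real.arctan_lt_pi_div_two (x / c)
    have := Real.neg_pi_div_two_lt_arctan (x / c⁻¹)
    have := Real.neg_pi_div_two_lt_arctan (x / c)
    constructor <;> linarith
  have h2 : Tendsto (fun c : ℝ => ∫ u in Ioi (0 : ℝ),
      (Real.exp (-c⁻¹ * u) - Real.exp (-c * u)) * ((charFun ν u).im / u)) atTop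
      (𝓝 (∫ u in Ioi (0 : ℝ), (charFun ν u).im / u)) := by
    refine tendsto_integral_filter_of_dominated_convergence
      (fun u => ‖(charFun ν u).im / u‖) (Eventually.of_forall fun c => ?_) ?_ hψ.norm ?_
    · exact AEStronglyMeasurable.mul (by fun_prop) hψ.aestronglyMeasurable
    · filter_upwards [eventually_ge_atTop 1] with c hc
      filter_upwards [ae_restrict_mem measurableSet_Ioi] with u hu
      rw [norm_mul]
      refine mul_le_of_le_one_left (norm_nonneg _) ?_
      have hu : 0 < u := hu
      have hc0 : 0 < c := by linarith
      have e1 : Real.exp (-c⁻¹ * u) ≤ 1 := Real.exp_le_one_iff.2 (by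
        have := mul_pos (inv_pos.2 hc0) hu
        linarith)
      have e2 : Real.exp (-c * u) ≤ 1 := Real.exp_le_one_iff.2 (by nlinarith)
      have := Real.exp_pos (-c⁻¹ * u)
      have := Real.exp_pos (-c * u)
      rw [Real.norm_eq_abs, abs_le]
      constructor <;> linarith
    · filter_upwards [ae_restrict_mem measurableSet_Ioi] with u hu
      have hu : 0 < u := hu
      have t1 : Tendsto (fun c : ℝ => Real.exp (-c⁻¹ * u)) atTop (𝓝 1) := by
        have : Tendsto (fun c : ℝ => -c⁻¹ * u) atTop (𝓝 (-0 * u)) :=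
          (tendsto_inv_atTop_zero.neg).mul_const u
        simpa [Function.comp_def] using (Real.continuous_exp.tendsto _).comp this
      have t2 : Tendsto (fun c : ℝ => Real.exp (-c * u)) atTop (𝓝 0) :=
        Real.tendsto_exp_atBot.comp (tendsto_neg_atTop_atBot.atBot_mul_const hu)
      simpa using (t1.sub t2).mul_const ((charFun ν u).im / u)
  rw [← integral_const_mul]
  refine tendsto_nhds_unique h1 (h2.congr' ?_)
  filter_upwards [eventually_ge_atTop 1] with c hc
  rw [integral_arctan_sub_arctan (by positivity) (by linarith [inv_le_one_of_one_le₀ hc])]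

/-- The function `a² / (a² + x²)` dominates the indicator of `{0}`, and by Fubini its integral is `a
∫ exp (-a u) Re (charFun ν u) du ≤ a K`, which vanishes as `a → 0`. -/
theorem measureReal_singleton_zero {ν : Measure ℝ} [IsProbabilityMeasure ν]
    (hψ : IntegrableOn (fun u : ℝ => (charFun ν u).re) (Ioi 0)) : ν.real {0} = 0 := by
  set K := ∫ u in Ioi (0 : ℝ), ‖(charFun ν u).re‖ with hK
  have hmain : ∀ a : ℝ, 0 < a → ν.real {0} ≤ a * K := by
    intro a ha
    have hF : Integrable (fun p : ℝ × ℝ => Real.exp (-a * p.2) * Real.cos (p.2 * p.1))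
        (ν.prod (volume.restrict (Ioi 0))) := by
      have hw : Integrable (fun u : ℝ => Real.exp (-a * u)) (volume.restrict (Ioi 0)) :=
        integrableOn_exp_neg_mul_Ioi ha
      refine (hw.comp_snd ν).norm.mono' (by fun_prop) (ae_of_all _ fun p => ?_)
      rw [norm_mul]
      exact mul_le_of_le_one_right (norm_nonneg _) (Real.abs_cos_le_one _)
    have h1 : ∫ x, a / (a ^ 2 + x ^ 2) ∂ν =
        ∫ u in Ioi (0 : ℝ), Real.exp (-a * u) * (charFun ν u).re := by
      simp_rw [← integral_exp_neg_mul_cos ha]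
      rw [integral_integral_swap hF]
      simp_rw [integral_const_mul, charFun_re]
    have h2 : ∫ u in Ioi (0 : ℝ), Real.exp (-a * u) * (charFun ν u).re ≤ K := by
      refine integral_mono_ae ?_ hψ.norm ?_
      · refine hψ.norm.mono' (AEStronglyMeasurable.mul (by fun_prop) hψ.aestronglyMeasurable) ?_
        filter_upwards [ae_restrict_mem measurableSet_Ioi] with u hu
        rw [norm_mul]
        refine mul_le_of_le_one_left (norm_nonneg _) ?_
        rw [Real.norm_eq_abs, abs_of_pos (Real.exp_pos _), Real.exp_le_one_iff]
        have hu : 0 < u := hu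
        nlinarith
      · filter_upwards [ae_restrict_mem measurableSet_Ioi] with u hu
        have hu : 0 < u := hu
        refine (le_abs_self _).trans ?_
        rw [abs_mul, abs_of_pos (Real.exp_pos _)]
        refine mul_le_of_le_one_left (abs_nonneg _) ?_
        rw [Real.exp_le_one_iff]
        nlinarith
    have hi : Integrable (fun x : ℝ => a / (a ^ 2 + x ^ 2)) ν := by
      refine (integrable_const (1 / a)).mono'
        (by fun_prop : Measurable _).aestronglyMeasurable (ae_of_all _ fun x => ?_)
      rw [Real.norm_eq_abs, abs_of_nonneg (by positivity), div_le_div_iff₀ (by positivity) ha]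
      nlinarith [sq_nonneg x]
    have h3 : ν.real {0} ≤ ∫ x, a * (a / (a ^ 2 + x ^ 2)) ∂ν := by
      rw [← integral_indicator_one (measurableSet_singleton (0 : ℝ))]
      refine integral_mono ((integrable_const (1 : ℝ)).indicator (measurableSet_singleton _))
        (hi.const_mul a) fun x => ?_
      by_cases hx : x = 0
      · subst hx; simp; field_simp; rfl
      · simp [hx]; positivity
    rw [integral_const_mul, h1] at h3
    nlinarith
  have hlim : Tendsto (fun a : ℝ => a * K) (𝓝[>] 0) (𝓝 0) := by
    have : Tendsto (fun a : ℝ => a * K) (𝓝 0) (𝓝 (0 * K)) := tendsto_id.mul_const K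
    rw [zero_mul] at this
    exact this.mono_left nhdsWithin_le_nhds
  refine le_antisymm (ge_of_tendsto hlim ?_) measureReal_nonneg
  filter_upwards [self_mem_nhdsWithin] with a ha using hmain a ha

/-! ### Stable laws: sign probabilities, positivity and the law of the ratio. -/

/-- The substitution `v = u ^ α` turns `du / u` into `dv / (α v)`. -/
theorem integral_exp_neg_mul_rpow_mul_sin_div {α a b : ℝ} (hα : 0 < α) (ha : 0 < a) :
    IntegrableOn (fun u : ℝ => Real.exp (-a * u ^ α) * Real.sin (u ^ α * b) / u) (Ioi 0) ∧
    ∫ u in Ioi (0 : ℝ), Real.exp (-a * u ^ α) * Real.sin (u ^ α * b) / u =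
      Real.arctan (b / a) / α := by
  have hcongr : EqOn (fun u : ℝ => (|α| * u ^ (α - 1)) •
      (Real.exp (-a * u ^ α) * (Real.sin (u ^ α * b) / u ^ α)))
      (fun u : ℝ => α * (Real.exp (-a * u ^ α) * Real.sin (u ^ α * b) / u)) (Ioi 0) := by
    intro u hu
    have hu : 0 < u := hu
    have hp : 0 < u ^ α := Real.rpow_pos_of_pos hu α
    simp only [smul_eq_mul, abs_of_pos hα, Real.rpow_sub_one hu.ne']
    field_simp
  have hi := (integrableOn_Ioi_comp_rpow_iff
    (fun v : ℝ => Real.exp (-a * v) * (Real.sin (v * b) / v)) hα.ne').2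
    (integrableOn_exp_neg_mul_sin_div ha b)
  have hv := integral_comp_rpow_Ioi
    (fun v : ℝ => Real.exp (-a * v) * (Real.sin (v * b) / v)) hα.ne'
  rw [integral_exp_neg_mul_sin_div ha, setIntegral_congr_fun measurableSet_Ioi hcongr,
    integral_const_mul] at hv
  have hi' := hi.congr_fun hcongr measurableSet_Ioi
  constructor
  · have := Integrable.const_mul hi' α⁻¹
    refine this.congr (ae_of_all _ fun u => ?_)
    simp only
    rw [inv_mul_cancel_left₀ hα.ne']
  · rw [← hv, mul_div_cancel_left₀ _ hα.ne']

/-- Sign probabilities of a strictly stable law with exponent `-(a - i b) u ^ α` on `u > 0`. -/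
theorem stable_measureReal_Iio {ν : Measure ℝ} [IsProbabilityMeasure ν] {α a b : ℝ}
    (hα : 0 < α) (ha : 0 < a)
    (hν : ∀ u : ℝ, 0 < u →
      charFun ν u = Complex.exp (-((u ^ α : ℝ) : ℂ) * ((a : ℂ) - b * Complex.I))) :
    ν.real {0} = 0 ∧ ν.real (Iio 0) = 1 / 2 - Real.arctan (b / a) / (Real.pi * α) := by
  have hre : ∀ u ∈ Ioi (0 : ℝ),
      Real.exp (-a * u ^ α) * Real.cos (u ^ α * b) = (charFun ν u).re := by
    intro u hu
    rw [hν u hu]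
    simp [Complex.exp_re, mul_comm]
  have him : ∀ u ∈ Ioi (0 : ℝ),
      Real.exp (-a * u ^ α) * Real.sin (u ^ α * b) / u = (charFun ν u).im / u := by
    intro u hu
    rw [hν u hu]
    simp [Complex.exp_im, mul_comm]
  have h0 : ν.real {0} = 0 := by
    refine measureReal_singleton_zero (IntegrableOn.congr_fun ?_ hre measurableSet_Ioi)
    have hi := integrableOn_rpow_mul_exp_neg_mul_rpow (p := α) (s := 0) (by norm_num) hα ha
    simp only [Real.rpow_zero, one_mul] at hi
    refine hi.mono' (by fun_prop) (ae_of_all _ fun u => ?_)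
    rw [norm_mul, Real.norm_eq_abs, abs_of_pos (Real.exp_pos _)]
    exact mul_le_of_le_one_right (Real.exp_pos _).le (Real.abs_cos_le_one _)
  refine ⟨h0, ?_⟩
  obtain ⟨hi, hv⟩ := integral_exp_neg_mul_rpow_mul_sin_div (b := b) hα ha
  have hs := integral_sign_eq (hi.congr_fun him measurableSet_Ioi)
  rw [← setIntegral_congr_fun measurableSet_Ioi him, hv] at hs
  have hsign : ∫ x, Real.sign x ∂ν = ν.real (Ioi 0) - ν.real (Iio 0) := by
    have hi1 : Integrable ((Ioi (0 : ℝ)).indicator (1 : ℝ → ℝ)) ν :=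
      (integrable_const (1 : ℝ)).indicator measurableSet_Ioi
    have hi2 : Integrable ((Iio (0 : ℝ)).indicator (1 : ℝ → ℝ)) ν :=
      (integrable_const (1 : ℝ)).indicator measurableSet_Iio
    rw [← integral_indicator_one measurableSet_Ioi, ← integral_indicator_one measurableSet_Iio,
      ← integral_sub hi1 hi2]
    refine integral_congr_ae (ae_of_all _ fun x => ?_)
    rcases lt_trichotomy x 0 with hx | rfl | hx
    · simp [Real.sign_of_neg hx, hx, hx.le]
    · simp
    · simp [Real.sign_of_pos hx, hx, hx.le]
  have hone : ν.real (Ioi 0) + ν.real (Iio 0) = 1 := by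
    have h1 := probReal_compl_eq_one_sub (μ := ν) (measurableSet_Iic (a := (0 : ℝ)))
    rw [compl_Iic, ← Iio_insert, Set.insert_eq, measureReal_union (by simp) measurableSet_Iio,
      h0] at h1
    linarith
  rw [hsign] at hs
  have hpi := Real.pi_pos
  have : ν.real (Ioi 0) = 1 - ν.real (Iio 0) := by linarith
  rw [this] at hs
  field_simp at hs ⊢
  linarith

theorem IsMaxSkewedStable.charFun_mul {α : ℝ} {μ : Measure ℝ} (hμ : IsMaxSkewedStable α μ)
    (c : ℝ) {u : ℝ} (hu : 0 < u) :
    charFun μ (c * u) = Complex.exp (-((u ^ α : ℝ) : ℂ) * (((|c| ^ α : ℝ) : ℂ) -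
      ((Real.tan (Real.pi * α / 2) * (Real.sign c * |c| ^ α) : ℝ) : ℂ) * Complex.I)) := by
  have hs : Real.sign (c * u) = Real.sign c := by
    rcases lt_trichotomy c 0 with hc | rfl | hc
    · rw [Real.sign_of_neg hc, Real.sign_of_neg (mul_neg_of_neg_of_pos hc hu)]
    · simp
    · rw [Real.sign_of_pos hc, Real.sign_of_pos (mul_pos hc hu)]
  rw [hμ.2, hs, abs_mul, abs_of_pos hu, Real.mul_rpow (abs_nonneg c) hu.le]
  congr 1
  push_cast
  ring

/-- Maximal skewness makes `b / a = tan (π α / 2)`. For `α < 1` the arctangent returns `π α / 2`,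
and the mass of the negative axis is `1/2 - 1/2`. -/
theorem IsMaxSkewedStable.ae_pos {α : ℝ} {μ : Measure ℝ} (hμ : IsMaxSkewedStable α μ)
    (hα : α ∈ Ioo (0 : ℝ) 1) : ∀ᵐ x ∂μ, 0 < x := by
  have := hμ.1
  have hpi := Real.pi_pos
  obtain ⟨h0, h1⟩ := stable_measureReal_Iio (ν := μ) (a := 1) (b := Real.tan (Real.pi * α / 2))
    hα.1 one_pos (fun u hu => by simpa using hμ.charFun_mul 1 hu)
  rw [div_one, Real.arctan_tan (by nlinarith [hα.1]) (by nlinarith [hα.2])] at h1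
  have h1' : μ.real (Iio 0) = 0 := by
    rw [h1]
    have := hα.1
    field_simp
    norm_num
  rw [measureReal_eq_zero_iff] at h0 h1'
  have : μ (Iic 0) = 0 := by
    rw [← Iio_insert, Set.insert_eq]
    exact measure_union_null h0 h1'
  rw [ae_iff]
  simpa [not_lt] using! this

/-- The distribution function, in terms of `u`, of `(S₂ / S₁) ^ α` for independent positive
`α`-stable variables (Lamperti's law). -/
noncomputable def lampertiCDF (α u : ℝ) : ℝ :=
  1 / 2 - Real.arctan (Real.tan (Real.pi * α / 2) * ((1 - u) / (1 + u))) / (Real.pi * α)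

/-- By positivity the event is `S₂ - r S₁ ≤ 0` with `r ^ α = t ^ (1 - α)`, and `S₂ - r S₁` is stable
with `a = 1 + r ^ α` and `b = tan (π α / 2) (1 - r ^ α)`. -/
theorem ratioCDF_eq_lampertiCDF {α : ℝ} {μ : Measure ℝ} (hμ : IsMaxSkewedStable α μ)
    (hα : α ∈ Ioo (0 : ℝ) 1) {t : ℝ} (ht : 0 < t) :
    ratioCDF α μ t = lampertiCDF α (t ^ (1 - α)) := by
  have := hμ.1
  obtain ⟨hα0, hα1⟩ := hα
  set r := t ^ ((1 - α) / α) with hr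
  have hr0 : 0 < r := Real.rpow_pos_of_pos ht _
  have hrα : r ^ α = t ^ (1 - α) := by
    rw [hr, ← Real.rpow_mul ht.le, div_mul_cancel₀ _ hα0.ne']
  have hγ : 0 < α / (1 - α) := div_pos hα0 (by linarith)
  have hrt : r ^ (α / (1 - α)) = t := by
    rw [hr, ← Real.rpow_mul ht.le]
    have : (1 - α) ≠ 0 := by linarith
    rw [show (1 - α) / α * (α / (1 - α)) = 1 by field_simp, Real.rpow_one]
  set ν := (μ.prod μ).map (fun p : ℝ × ℝ => 1 * p.2 + (-r) * p.1) with hν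
  have hm : Measurable (fun p : ℝ × ℝ => 1 * p.2 + (-r) * p.1) := by fun_prop
  have hνp : IsProbabilityMeasure ν := Measure.isProbabilityMeasure_map hm.aemeasurable
  have hind : IndepFun (fun p : ℝ × ℝ => 1 * p.2) (fun p : ℝ × ℝ => (-r) * p.1) (μ.prod μ) :=
    (indepFun_prod (μ := μ) (ν := μ) (X := fun x => (-r) * x) (Y := fun y => 1 * y)
      (by fun_prop) (by fun_prop)).symm
  have hchar : ∀ u : ℝ, 0 < u → charFun ν u = Complex.exp (-((u ^ α : ℝ) : ℂ) *
      (((1 + r ^ α : ℝ) : ℂ) -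
        ((Real.tan (Real.pi * α / 2) * (1 - r ^ α) : ℝ) : ℂ) * Complex.I)) := by
    intro u hu
    rw [hν, hind.charFun_map_fun_add_eq_mul (by fun_prop) (by fun_prop), Pi.mul_apply,
      charFun_map_mul_comp (by fun_prop), charFun_map_mul_comp (by fun_prop),
      (measurePreserving_snd (μ := μ) (ν := μ)).map_eq,
      (measurePreserving_fst (μ := μ) (ν := μ)).map_eq, hμ.charFun_mul _ hu, hμ.charFun_mul _ hu,
      ← Complex.exp_add, Real.sign_of_neg (neg_neg_of_pos hr0), Real.sign_of_pos one_pos, abs_neg,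
      abs_of_pos hr0, abs_one, Real.one_rpow]
    congr 1
    push_cast
    ring
  obtain ⟨h0, h1⟩ := stable_measureReal_Iio hα0 (by positivity) hchar
  have hset : {p : ℝ × ℝ | (p.2 / p.1) ^ (α / (1 - α)) ≤ t} =ᵐ[μ.prod μ]
      (fun p : ℝ × ℝ => 1 * p.2 + (-r) * p.1) ⁻¹' (Iic 0) := by
    have e1 : ∀ᵐ p ∂(μ.prod μ), 0 < p.1 :=
      (Measure.quasiMeasurePreserving_fst (μ := μ) (ν := μ)).ae (hμ.ae_pos ⟨hα0, hα1⟩)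
    have e2 : ∀ᵐ p ∂(μ.prod μ), 0 < p.2 :=
      (Measure.quasiMeasurePreserving_snd (μ := μ) (ν := μ)).ae (hμ.ae_pos ⟨hα0, hα1⟩)
    filter_upwards [e1, e2] with p hp1 hp2
    refine propext ?_
    change (p.2 / p.1) ^ (α / (1 - α)) ≤ t ↔ 1 * p.2 + (-r) * p.1 ≤ 0
    rw [← hrt, Real.rpow_le_rpow_iff (div_pos hp2 hp1).le hr0.le hγ, div_le_iff₀ hp1]
    constructor <;> intro h <;> linarith
  rw [ratioCDF, measureReal_congr hset, ← map_measureReal_apply hm measurableSet_Iic, ← hν,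
    ← Iio_insert, Set.insert_eq, measureReal_union (by simp) measurableSet_Iio, h0, zero_add, h1,
    lampertiCDF, hrα, mul_div_assoc]

/-! ### Lower bounds for the Lamperti distribution function. -/

section
variable {α : ℝ}

theorem tan_pi_mul_div_two_pos (hα : α ∈ Ioo (0 : ℝ) 1) : 0 < Real.tan (Real.pi * α / 2) := by
  have hpi := Real.pi_pos
  exact Real.tan_pos_of_pos_of_lt_pi_div_two (by have := hα.1; positivity) (by nlinarith [hα.2])

theorem sin_pi_mul_pos (hα : α ∈ Ioo (0 : ℝ) 1) : 0 < Real.sin (Real.pi * α) := by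
  have hpi := Real.pi_pos
  exact Real.sin_pos_of_pos_of_lt_pi (by have := hα.1; positivity) (by nlinarith [hα.2])

theorem arctan_tan_pi_mul_div_two (hα : α ∈ Ioo (0 : ℝ) 1) :
    Real.arctan (Real.tan (Real.pi * α / 2)) = Real.pi * α / 2 := by
  have hpi := Real.pi_pos
  exact Real.arctan_tan (by nlinarith [hα.1]) (by nlinarith [hα.2])

theorem lampertiCDF_zero (hα : α ∈ Ioo (0 : ℝ) 1) : lampertiCDF α 0 = 0 := by
  have hpi := Real.pi_pos
  have := hα.1
  simp only [lampertiCDF, sub_zero, add_zero, div_one, mul_one, arctan_tan_pi_mul_div_two hα]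
  field_simp
  norm_num

theorem lampertiCDF_lt_one (hα : α ∈ Ioo (0 : ℝ) 1) {u : ℝ} (hu : 0 ≤ u) :
    lampertiCDF α u < 1 := by
  have hβ : 0 < Real.pi * α := mul_pos Real.pi_pos hα.1
  have hw : -1 < (1 - u) / (1 + u) := by
    rw [lt_div_iff₀ (by linarith)]; linarith
  have h : -(Real.pi * α / 2) <
      Real.arctan (Real.tan (Real.pi * α / 2) * ((1 - u) / (1 + u))) := by
    rw [show -(Real.pi * α / 2) = Real.arctan (-Real.tan (Real.pi * α / 2)) by
      rw [Real.arctan_neg, arctan_tan_pi_mul_div_two hα]]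
    refine Real.arctan_strictMono ?_
    nlinarith [tan_pi_mul_div_two_pos hα]
  have h' : -(1 / 2) <
      Real.arctan (Real.tan (Real.pi * α / 2) * ((1 - u) / (1 + u))) / (Real.pi * α) := by
    rw [lt_div_iff₀ hβ]; linarith
  rw [lampertiCDF]
  linarith

theorem one_add_two_mul_cos_add_sq_pos (hα : α ∈ Ioo (0 : ℝ) 1) (u : ℝ) :
    0 < 1 + 2 * u * Real.cos (Real.pi * α) + u ^ 2 := by
  have := sin_pi_mul_pos hα
  nlinarith [sq_nonneg (u + Real.cos (Real.pi * α)), Real.sin_sq_add_cos_sq (Real.pi * α),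
    sq_pos_of_pos this]

theorem hasDerivAt_lampertiCDF (hα : α ∈ Ioo (0 : ℝ) 1) {u : ℝ} (hu : -1 < u) :
    HasDerivAt (lampertiCDF α) (Real.sin (Real.pi * α) / (Real.pi * α) /
      (1 + 2 * u * Real.cos (Real.pi * α) + u ^ 2)) u := by
  have hβ : 0 < Real.pi * α := mul_pos Real.pi_pos hα.1
  have hu1 : (1 : ℝ) + u ≠ 0 := by linarith
  have hw : HasDerivAt (fun u : ℝ => (1 - u) / (1 + u)) (-2 / (1 + u) ^ 2) u := by
    convert! ((hasDerivAt_id u).const_sub 1).div ((hasDerivAt_id u).const_add 1) hu1 using 1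
    simp only [id]
    ring
  have h := ((Real.hasDerivAt_arctan _).comp u
    (hw.const_mul (Real.tan (Real.pi * α / 2)))).div_const (Real.pi * α) |>.const_sub (1 / 2)
  convert! h using 1
  have hpos := one_add_two_mul_cos_add_sq_pos hα u
  -- In the half angle, sine, cosine and tangent are all rational in `sin a` and `cos a`, so the
  -- density becomes an algebraic identity.
  set a := Real.pi * α / 2 with ha
  have hβa : Real.pi * α = 2 * a := by rw [ha]; ring
  have hc : 0 < Real.cos a := by
    have hpi := Real.pi_pos
    exact Real.cos_pos_of_mem_Ioo ⟨by nlinarith [hα.1], by nlinarith [hα.2]⟩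
  rw [hβa] at hpos hβ ⊢
  rw [Real.sin_two_mul, Real.cos_two_mul] at *
  rw [Real.tan_eq_sin_div_cos]
  have hs : Real.sin a ^ 2 = 1 - Real.cos a ^ 2 := by
    linarith [Real.sin_sq_add_cos_sq a]
  have hden : 1 + (Real.sin a / Real.cos a * ((1 - u) / (1 + u))) ^ 2 =
      (1 + 2 * u * (2 * Real.cos a ^ 2 - 1) + u ^ 2) / (Real.cos a ^ 2 * (1 + u) ^ 2) := by
    field_simp
    rw [hs]
    ring
  rw [hden]
  have hne := hpos.ne'
  field_simp

/-- Since `cos (π α) ≤ 1`, the density is at least `k / (1 + v)²`, whose primitive is `k v / (1 +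
v)`. -/
theorem le_lampertiCDF (hα : α ∈ Ioo (0 : ℝ) 1) {u : ℝ} (hu : 0 ≤ u) :
    Real.sin (Real.pi * α) / (Real.pi * α) * (u / (1 + u)) ≤ lampertiCDF α u := by
  have hβ : 0 < Real.pi * α := mul_pos Real.pi_pos hα.1
  have hk : 0 < Real.sin (Real.pi * α) / (Real.pi * α) := div_pos (sin_pi_mul_pos hα) hβ
  set k := Real.sin (Real.pi * α) / (Real.pi * α)
  have hd : ∀ v : ℝ, 0 ≤ v → HasDerivAt (fun v => lampertiCDF α v - k * (v / (1 + v)))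
      (k / (1 + 2 * v * Real.cos (Real.pi * α) + v ^ 2) - k * (1 / (1 + v) ^ 2)) v := by
    intro v hv
    refine (hasDerivAt_lampertiCDF hα (by linarith)).sub (HasDerivAt.const_mul k ?_)
    convert! (hasDerivAt_id v).div ((hasDerivAt_id v).const_add 1) (by simp; linarith) using 1
    simp
  have hmono : MonotoneOn (fun v => lampertiCDF α v - k * (v / (1 + v))) (Ici 0) := by
    refine monotoneOn_of_deriv_nonneg (convex_Ici 0)
      (fun v hv => (hd v hv).continuousAt.continuousWithinAt)
      (fun v hv => ((hd v (interior_subset hv)).differentiableAt).differentiableWithinAt) ?_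
    intro v hv
    have hv0 : 0 ≤ v := interior_subset hv
    rw [(hd v hv0).deriv, div_eq_mul_one_div k, ← mul_sub]
    refine mul_nonneg hk.le (sub_nonneg.2 ?_)
    refine one_div_le_one_div_of_le (one_add_two_mul_cos_add_sq_pos hα v) ?_
    nlinarith [Real.cos_le_one (Real.pi * α)]
  have := hmono self_mem_Ici hu hu
  simp only [lampertiCDF_zero hα, zero_div, mul_zero, sub_zero] at this
  linarith

theorem lampertiCDF_pos (hα : α ∈ Ioo (0 : ℝ) 1) {u : ℝ} (hu : 0 < u) : 0 < lampertiCDF α u := by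
  have hβ : 0 < Real.pi * α := mul_pos Real.pi_pos hα.1
  have := sin_pi_mul_pos hα
  exact lt_of_lt_of_le (by positivity) (le_lampertiCDF hα hu.le)

theorem mul_sin_le_mul_sin {d a : ℝ} (hd : 0 ≤ d) (hda : d ≤ a) (ha : a ≤ Real.pi) :
    d * Real.sin a ≤ a * Real.sin d := by
  rcases hd.eq_or_lt with rfl | hd
  · simp
  have ha0 : 0 < a := hd.trans_le hda
  have h := strictConcaveOn_sin_Icc.concaveOn.2
    (show (0 : ℝ) ∈ Icc 0 Real.pi from ⟨le_rfl, Real.pi_pos.le⟩)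
    (show a ∈ Icc 0 Real.pi from ⟨ha0.le, ha⟩)
    (show 0 ≤ 1 - d / a by rw [sub_nonneg, div_le_one ha0]; exact hda)
    (show 0 ≤ d / a by positivity) (by ring)
  simp only [Real.sin_zero, smul_eq_mul, mul_zero, zero_add, div_mul_cancel₀ _ ha0.ne'] at h
  rw [div_mul_eq_mul_div, div_le_iff₀ ha0] at h
  linarith

/-- This is the sign of the derivative in `log_sin_sub_log_sin_le`. With `a = π α / 2` and `d = π α
(1/2 - f)` the product of sines is `sin² a - sin² d`. Concavity of the sine bounds it by `sin² a (1
- d² / a²)`, and Jordan's inequality `1 - α ≤ cos a` with `sin a ≤ a` does the rest. -/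
theorem one_sub_mul_sin_mul_sin_le (hα : α ∈ Ioo (0 : ℝ) 1) {f : ℝ} (hf : 0 < f)
    (hf2 : f ≤ 1 / 2) :
    (1 - α) * (Real.sin (Real.pi * α * f) * Real.sin (Real.pi * α * (1 - f))) ≤
      Real.pi * α * Real.sin (Real.pi * α) * (f * (1 - f)) := by
  have hpi := Real.pi_pos
  set a := Real.pi * α / 2 with ha
  set d := Real.pi * α * (1 / 2 - f) with hd
  have ha0 : 0 < a := by have := hα.1; positivity
  have hβ : 0 < Real.pi * α := mul_pos Real.pi_pos hα.1
  have hd0 : 0 ≤ d := mul_nonneg hβ.le (by linarith)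
  have hda : d ≤ a := by rw [ha, hd]; nlinarith
  have hapi : a ≤ Real.pi / 2 := by rw [ha]; nlinarith [hα.2]
  have e1 : Real.pi * α * f = a - d := by rw [ha, hd]; ring
  have e2 : Real.pi * α * (1 - f) = a + d := by rw [ha, hd]; ring
  have e3 : Real.pi * α = 2 * a := by rw [ha]; ring
  have e4 : (1 : ℝ) - α = 1 - 2 / Real.pi * a := by rw [ha]; field_simp
  have hprod : Real.sin (a - d) * Real.sin (a + d) = Real.sin a ^ 2 - Real.sin d ^ 2 := by
    rw [Real.sin_sub, Real.sin_add]
    nlinarith [Real.sin_sq_add_cos_sq a, Real.sin_sq_add_cos_sq d]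
  have hsd := mul_sin_le_mul_sin hd0 hda (by linarith)
  have hsa : 0 < Real.sin a := Real.sin_pos_of_pos_of_lt_pi ha0 (by linarith)
  have hca : 0 ≤ Real.cos a := Real.cos_nonneg_of_mem_Icc ⟨by linarith, hapi⟩
  have h1 : (Real.sin a ^ 2 - Real.sin d ^ 2) * a ^ 2 ≤ Real.sin a ^ 2 * (a ^ 2 - d ^ 2) := by
    have := pow_le_pow_left₀ (mul_nonneg hd0 hsa.le) hsd 2
    nlinarith
  have h2 : (1 - α) * Real.sin a ≤ a * Real.cos a := by
    have hJ := Real.one_sub_mul_le_cos ha0.le hapi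
    rw [← e4] at hJ
    calc (1 - α) * Real.sin a ≤ Real.cos a * a :=
          mul_le_mul hJ (Real.sin_le ha0.le) hsa.le hca
      _ = _ := mul_comm _ _
  have hff : f * (1 - f) * (2 * a) ^ 2 = a ^ 2 - d ^ 2 := by rw [hd, ha]; ring
  have hα1 : 0 < 1 - α := by linarith [hα.2]
  have had : 0 ≤ a ^ 2 - d ^ 2 := by nlinarith
  rw [e1, e2, e3, hprod, Real.sin_two_mul]
  refine le_of_mul_le_mul_right ?_ (sq_pos_of_pos ha0)
  calc (1 - α) * (Real.sin a ^ 2 - Real.sin d ^ 2) * a ^ 2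
      ≤ (1 - α) * (Real.sin a ^ 2 * (a ^ 2 - d ^ 2)) := by
        rw [mul_assoc]; exact mul_le_mul_of_nonneg_left h1 hα1.le
    _ = ((1 - α) * Real.sin a) * (Real.sin a * (a ^ 2 - d ^ 2)) := by ring
    _ ≤ (a * Real.cos a) * (Real.sin a * (a ^ 2 - d ^ 2)) :=
        mul_le_mul_of_nonneg_right h2 (mul_nonneg hsa.le had)
    _ = _ := by rw [← hff]; ring

/-- The difference `D` of the two sides vanishes at `1/2` by symmetry and decreases on `(0, 1/2]`.
-/
theorem log_sin_sub_log_sin_le (hα : α ∈ Ioo (0 : ℝ) 1) {f : ℝ} (hf : 0 < f) (hf2 : f ≤ 1 / 2) :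
    Real.log (Real.sin (Real.pi * α * f)) - Real.log (Real.sin (Real.pi * α * (1 - f))) ≤
      (1 - α) * (Real.log f - Real.log (1 - f)) := by
  have hβ : 0 < Real.pi * α := mul_pos Real.pi_pos hα.1
  have hβpi : Real.pi * α < Real.pi := by nlinarith [hα.2, Real.pi_pos]
  have hsin : ∀ g : ℝ, 0 < g → g < 1 → 0 < Real.sin (Real.pi * α * g) := fun g h0 h1 =>
    Real.sin_pos_of_pos_of_lt_pi (by positivity) (by nlinarith)
  set D : ℝ → ℝ := fun g => (1 - α) * (Real.log g - Real.log (1 - g)) -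
    (Real.log (Real.sin (Real.pi * α * g)) - Real.log (Real.sin (Real.pi * α * (1 - g)))) with hD
  have hd : ∀ g ∈ Ioo (0 : ℝ) 1, HasDerivAt D ((1 - α) * (1 / g - -1 / (1 - g)) -
      (Real.cos (Real.pi * α * g) * (Real.pi * α) / Real.sin (Real.pi * α * g) -
        Real.cos (Real.pi * α * (1 - g)) * (Real.pi * α * -1) /
          Real.sin (Real.pi * α * (1 - g)))) g := by
    intro g hg
    have i1 : HasDerivAt (fun g : ℝ => 1 - g) (-1) g := by
      simpa using (hasDerivAt_id g).const_sub 1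
    have i2 : HasDerivAt (fun g : ℝ => Real.pi * α * g) (Real.pi * α) g := by
      simpa using (hasDerivAt_id g).const_mul (Real.pi * α)
    have i3 : HasDerivAt (fun g : ℝ => Real.pi * α * (1 - g)) (Real.pi * α * -1) g :=
      i1.const_mul (Real.pi * α)
    exact ((((hasDerivAt_id g).log hg.1.ne').sub
      (i1.log (by linarith [hg.2]))).const_mul (1 - α)).sub
      ((i2.sin.log (hsin g hg.1 hg.2).ne').sub
        (i3.sin.log (hsin (1 - g) (by linarith [hg.2]) (by linarith [hg.1])).ne'))
  have hsub : Ioc (0 : ℝ) (1 / 2) ⊆ Ioo 0 1 := fun g hg => ⟨hg.1, by linarith [hg.2]⟩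
  have hanti : AntitoneOn D (Ioc 0 (1 / 2)) := by
    refine antitoneOn_of_deriv_nonpos (convex_Ioc 0 (1 / 2))
      (fun v hv => (hd v (hsub hv)).continuousAt.continuousWithinAt)
      (fun v hv => ((hd v (hsub (interior_subset hv))).differentiableAt).differentiableWithinAt) ?_
    intro g hg
    have hg' := interior_subset hg
    have hg1 := hsub hg'
    rw [(hd g hg1).deriv]
    have s1 := hsin g hg1.1 hg1.2
    have s2 := hsin (1 - g) (by linarith [hg1.2]) (by linarith [hg1.1])
    have key := one_sub_mul_sin_mul_sin_le hα hg'.1 hg'.2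
    have hadd : Real.sin (Real.pi * α) =
        Real.sin (Real.pi * α * g) * Real.cos (Real.pi * α * (1 - g)) +
        Real.cos (Real.pi * α * g) * Real.sin (Real.pi * α * (1 - g)) := by
      rw [← Real.sin_add]; ring_nf
    have hg2 : 0 < 1 - g := by linarith [hg1.2]
    have hg0 := hg1.1
    rw [hadd] at key
    have e : (1 - α) * (1 / g - -1 / (1 - g)) -
      (Real.cos (Real.pi * α * g) * (Real.pi * α) / Real.sin (Real.pi * α * g) -
        Real.cos (Real.pi * α * (1 - g)) * (Real.pi * α * -1) /
          Real.sin (Real.pi * α * (1 - g))) =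
      ((1 - α) * (Real.sin (Real.pi * α * g) * Real.sin (Real.pi * α * (1 - g))) -
        Real.pi * α * (Real.sin (Real.pi * α * g) * Real.cos (Real.pi * α * (1 - g)) +
        Real.cos (Real.pi * α * g) * Real.sin (Real.pi * α * (1 - g))) * (g * (1 - g))) /
      (g * (1 - g) * Real.sin (Real.pi * α * g) * Real.sin (Real.pi * α * (1 - g))) := by
      generalize Real.sin (Real.pi * α * g) = x at s1 ⊢
      generalize Real.sin (Real.pi * α * (1 - g)) = y at s2 ⊢
      field_simp
      ring
    rw [e]
    exact div_nonpos_of_nonpos_of_nonneg (by linarith) (by positivity)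
  have h := hanti ⟨hf, hf2⟩ ⟨by norm_num, le_rfl⟩ hf2
  have h0 : D (1 / 2) = 0 := by
    simp only [hD]; norm_num
  rw [h0] at h
  simp only [hD] at h
  linarith

/-- The quantile of `L` at level `f` is `sin (π α f) / sin (π α (1 - f))`. For `f = t / (1 + t)` one
has `f / (1 - f) = t`, so the claim says that this quantile is at most `(f / (1 - f)) ^ (1 - α)`,
which is `log_sin_sub_log_sin_le` exponentiated. -/
theorem div_one_add_le_lampertiCDF (hα : α ∈ Ioo (0 : ℝ) 1) {t : ℝ} (ht : 0 < t) (ht1 : t ≤ 1) :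
    t / (1 + t) ≤ lampertiCDF α (t ^ (1 - α)) := by
  have hpi := Real.pi_pos
  have hβ : 0 < Real.pi * α := mul_pos Real.pi_pos hα.1
  have hβpi : Real.pi * α < Real.pi := by nlinarith [hα.2, Real.pi_pos]
  set f := t / (1 + t) with hf
  set u := t ^ (1 - α) with hu
  have hf0 : 0 < f := by positivity
  have hf2 : f ≤ 1 / 2 := by rw [hf, div_le_iff₀ (by linarith)]; linarith
  have hft : f / (1 - f) = t := by
    rw [hf]; field_simp; ring
  have hu0 : 0 < u := Real.rpow_pos_of_pos ht _
  set s1 := Real.sin (Real.pi * α * f) with hs1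
  set s2 := Real.sin (Real.pi * α * (1 - f)) with hs2
  have p1 : 0 < s1 := Real.sin_pos_of_pos_of_lt_pi (by positivity) (by nlinarith)
  have p2 : 0 < s2 := Real.sin_pos_of_pos_of_lt_pi (mul_pos hβ (by linarith)) (by nlinarith)
  have hle : s1 ≤ u * s2 := by
    have h := log_sin_sub_log_sin_le hα hf0 hf2
    rw [← Real.log_div hf0.ne' (by linarith), hft, ← Real.log_rpow ht,
      ← Real.log_div p1.ne' p2.ne', Real.log_le_log_iff (by positivity) hu0,
      div_le_iff₀ p2] at h
    exact h
  set a := Real.pi * α / 2 with ha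
  set d := Real.pi * α * (1 / 2 - f) with hd
  have hd0 : 0 ≤ d := mul_nonneg hβ.le (by linarith)
  have hapi : a < Real.pi / 2 := by rw [ha]; linarith
  have ha0 : 0 < a := by rw [ha]; positivity
  have hda : d ≤ a := by rw [ha, hd]; nlinarith
  have e1 : s1 = Real.sin (a - d) := by rw [hs1]; congr 1; rw [ha, hd]; ring
  have e2 : s2 = Real.sin (a + d) := by rw [hs2]; congr 1; rw [ha, hd]; ring
  have hca : 0 < Real.cos a := Real.cos_pos_of_mem_Ioo ⟨by linarith, hapi⟩
  have hcd : 0 < Real.cos d := Real.cos_pos_of_mem_Ioo ⟨by linarith, by linarith⟩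
  have hsa : 0 < Real.sin a := Real.sin_pos_of_pos_of_lt_pi ha0 (by linarith)
  have htan : Real.tan a * ((1 - u) / (1 + u)) ≤ Real.tan d := by
    have hw : (1 - u) / (1 + u) ≤ (s2 - s1) / (s2 + s1) := by
      rw [div_le_div_iff₀ (by linarith) (by linarith)]
      nlinarith
    have ht0 : 0 < Real.tan a := Real.tan_pos_of_pos_of_lt_pi_div_two ha0 hapi
    refine (mul_le_mul_of_nonneg_left hw ht0.le).trans (le_of_eq ?_)
    have m1 : s2 - s1 = 2 * (Real.cos a * Real.sin d) := by
      rw [e1, e2, Real.sin_add, Real.sin_sub]; ring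
    have m2 : s2 + s1 = 2 * (Real.sin a * Real.cos d) := by
      rw [e1, e2, Real.sin_add, Real.sin_sub]; ring
    rw [m1, m2, Real.tan_eq_sin_div_cos, Real.tan_eq_sin_div_cos]
    field_simp
  have harc := Real.arctan_mono htan
  rw [Real.arctan_tan (by linarith) (by linarith)] at harc
  have : Real.arctan (Real.tan a * ((1 - u) / (1 + u))) / (Real.pi * α) ≤ 1 / 2 - f := by
    rw [div_le_iff₀ hβ]
    linarith
  rw [lampertiCDF]
  linarith

/-- For `α = 1/2` the density is `(2 / π) / (1 + v²)`, while the previous bound at `t = v²` gives `1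
- L(v) ≤ 1 / (1 + v²)`. The hazard rate is thus at least `2 / π` on `(0, 1)`. -/
theorem one_sub_lampertiCDF_half_le {u : ℝ} (hu : 0 ≤ u) (hu1 : u ≤ 1) :
    1 - lampertiCDF (1 / 2) u ≤ Real.exp (-(2 / Real.pi * u)) := by
  have hpi := Real.pi_pos
  have hα : (1 / 2 : ℝ) ∈ Ioo (0 : ℝ) 1 := by norm_num
  have hd : ∀ v : ℝ, 0 ≤ v → HasDerivAt
      (fun v => (1 - lampertiCDF (1 / 2) v) * Real.exp (2 / Real.pi * v))
      (-(2 / Real.pi / (1 + v ^ 2)) * Real.exp (2 / Real.pi * v) +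
        (1 - lampertiCDF (1 / 2) v) * (Real.exp (2 / Real.pi * v) * (2 / Real.pi))) v := by
    intro v hv
    have h1 := hasDerivAt_lampertiCDF hα (show -1 < v by linarith)
    have hang : Real.pi * (1 / 2) = Real.pi / 2 := by ring
    rw [hang, Real.sin_pi_div_two, Real.cos_pi_div_two, mul_zero, add_zero, one_div_div] at h1
    have h2 : HasDerivAt (fun v : ℝ => 2 / Real.pi * v) (2 / Real.pi) v := by
      simpa using (hasDerivAt_id v).const_mul (2 / Real.pi)
    exact (h1.const_sub 1).mul h2.exp
  have hanti : AntitoneOn (fun v => (1 - lampertiCDF (1 / 2) v) * Real.exp (2 / Real.pi * v))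
      (Icc 0 1) := by
    refine antitoneOn_of_deriv_nonpos (convex_Icc 0 1)
      (fun v hv => (hd v hv.1).continuousAt.continuousWithinAt)
      (fun v hv => (hd v (interior_subset hv).1).differentiableAt.differentiableWithinAt) ?_
    intro v hv
    rw [interior_Icc] at hv
    rw [(hd v hv.1.le).deriv]
    have h := div_one_add_le_lampertiCDF hα (t := v ^ 2) (pow_pos hv.1 2)
      (by nlinarith [hv.1, hv.2])
    rw [show (1 : ℝ) - 1 / 2 = 1 / 2 by norm_num, ← Real.sqrt_eq_rpow,
      Real.sqrt_sq hv.1.le] at h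
    have e : v ^ 2 / (1 + v ^ 2) = 1 - 1 / (1 + v ^ 2) := by field_simp; ring
    rw [e] at h
    have : -(2 / Real.pi / (1 + v ^ 2)) * Real.exp (2 / Real.pi * v) +
        (1 - lampertiCDF (1 / 2) v) * (Real.exp (2 / Real.pi * v) * (2 / Real.pi)) =
        (1 - lampertiCDF (1 / 2) v - 1 / (1 + v ^ 2)) *
          (Real.exp (2 / Real.pi * v) * (2 / Real.pi)) := by ring
    rw [this]
    exact mul_nonpos_of_nonpos_of_nonneg (by linarith) (by positivity)
  have h := hanti ⟨le_rfl, zero_le_one⟩ ⟨hu, hu1⟩ hu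
  simp only [lampertiCDF_zero hα, sub_zero, mul_zero, Real.exp_zero, mul_one] at h
  rw [Real.exp_neg, ← one_div, le_div_iff₀ (Real.exp_pos _)]
  exact h

/-! ### Asymptotics at the origin and as `α → 0`. -/

theorem tendsto_rpow_nhdsGT_zero {p : ℝ} (hp : 0 < p) :
    Tendsto (fun t : ℝ => t ^ p) (𝓝[>] 0) (𝓝[>] 0) := by
  refine tendsto_nhdsWithin_iff.2 ⟨?_, ?_⟩
  · have := (Real.continuousAt_rpow_const 0 p (Or.inr hp.le)).tendsto
    rw [Real.zero_rpow hp.ne'] at this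
    exact this.mono_left nhdsWithin_le_nhds
  · filter_upwards [self_mem_nhdsWithin] with t ht using Real.rpow_pos_of_pos ht p

theorem HasDerivAt.tendsto_div_nhdsGT_zero {g : ℝ → ℝ} {g' : ℝ} (hg : HasDerivAt g g' 0)
    (h0 : g 0 = 0) : Tendsto (fun u => g u / u) (𝓝[>] 0) (𝓝 g') := by
  have h := (hasDerivAt_iff_tendsto_slope_zero.1 hg).mono_left
    (nhdsWithin_mono 0 (fun x (hx : 0 < x) => hx.ne'))
  refine h.congr fun u => ?_
  simp [h0, div_eq_inv_mul]

theorem hasDerivAt_lampertiCDF_zero (hα : α ∈ Ioo (0 : ℝ) 1) :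
    HasDerivAt (lampertiCDF α) (Real.sin (Real.pi * α) / (Real.pi * α)) 0 := by
  simpa using hasDerivAt_lampertiCDF hα (u := 0) (by norm_num)

theorem tendsto_div_lampertiCDF (hα : α ∈ Ioo (0 : ℝ) 1) :
    Tendsto (fun u => u / lampertiCDF α u) (𝓝[>] 0)
      (𝓝 (Real.pi * α / Real.sin (Real.pi * α))) := by
  have hβ : 0 < Real.pi * α := mul_pos Real.pi_pos hα.1
  have h := ((hasDerivAt_lampertiCDF_zero hα).tendsto_div_nhdsGT_zero
    (lampertiCDF_zero hα)).inv₀ (div_pos (sin_pi_mul_pos hα) hβ).ne'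
  simpa only [inv_div] using h

theorem tendsto_neg_log_one_sub_lampertiCDF_div (hα : α ∈ Ioo (0 : ℝ) 1) :
    Tendsto (fun u => -Real.log (1 - lampertiCDF α u) / u) (𝓝[>] 0)
      (𝓝 (Real.sin (Real.pi * α) / (Real.pi * α))) := by
  have h := (((hasDerivAt_lampertiCDF_zero hα).const_sub 1).log
    (by rw [lampertiCDF_zero hα]; norm_num)).neg
  rw [lampertiCDF_zero hα] at h
  refine HasDerivAt.tendsto_div_nhdsGT_zero ?_ (by simp [lampertiCDF_zero hα])
  convert! h using 1
  ring

theorem tendsto_mul_div_sin_zero :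
    Tendsto (fun α => Real.pi * α / Real.sin (Real.pi * α)) (𝓝[>] 0) (𝓝 1) := by
  have h : HasDerivAt (fun α => Real.sin (Real.pi * α)) Real.pi 0 := by
    have h2 : HasDerivAt (fun v : ℝ => Real.pi * v) Real.pi 0 := by
      simpa using (hasDerivAt_id (0 : ℝ)).const_mul Real.pi
    simpa using h2.sin
  have h' := ((h.tendsto_div_nhdsGT_zero (by simp)).inv₀ Real.pi_pos.ne').const_mul Real.pi
  rw [mul_inv_cancel₀ Real.pi_pos.ne'] at h'
  refine h'.congr fun α => ?_
  rw [inv_div, mul_div_assoc]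

/-- The argument of the arctangent is `(π α / 2) (w₀ + o(1))`, so after division by `π α` the limit
is `1/2 - w₀ / 2 = u₀ / (1 + u₀)`. -/
theorem tendsto_lampertiCDF_nhdsGT_zero {g : ℝ → ℝ} {u₀ : ℝ} (hu : 0 < u₀)
    (hg : Tendsto g (𝓝[>] 0) (𝓝 u₀)) :
    Tendsto (fun α => lampertiCDF α (g α)) (𝓝[>] 0) (𝓝 (u₀ / (1 + u₀))) := by
  have hpi := Real.pi_pos
  set w₀ := (1 - u₀) / (1 + u₀) with hw₀
  have hw : Tendsto (fun α => (1 - g α) / (1 + g α)) (𝓝[>] 0) (𝓝 w₀) :=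
    (hg.const_sub 1).div (hg.const_add 1) (by linarith)
  have hT : Tendsto (fun α => Real.tan (Real.pi * α / 2) / α) (𝓝[>] 0) (𝓝 (Real.pi / 2)) := by
    refine HasDerivAt.tendsto_div_nhdsGT_zero ?_ (by simp)
    have h2 : HasDerivAt (fun v : ℝ => Real.pi * v / 2) (Real.pi / 2) 0 := by
      simpa using ((hasDerivAt_id (0 : ℝ)).const_mul Real.pi).div_const 2
    have h1 : HasDerivAt Real.tan 1 (Real.pi * 0 / 2) := by
      simpa using Real.hasDerivAt_tan (x := 0) (by simp)
    simpa [Function.comp_def] using! h1.comp 0 h2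
  have hT0 : Tendsto (fun α => Real.tan (Real.pi * α / 2) * ((1 - g α) / (1 + g α)))
      (𝓝[>] 0) (𝓝 0) := by
    have hid : Tendsto (fun α : ℝ => α) (𝓝[>] 0) (𝓝 0) := tendsto_id.mono_left nhdsWithin_le_nhds
    have := (hT.mul hid).mul hw
    rw [mul_zero, zero_mul] at this
    refine this.congr' ?_
    filter_upwards [self_mem_nhdsWithin] with α hα
    rw [div_mul_cancel₀ _ (ne_of_gt hα)]
  -- `dslope` replaces `arctan z / z`, since `z` may vanish (when `g α = 1`).
  have hS : ContinuousAt (dslope Real.arctan 0) 0 :=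
    continuousAt_dslope_same.2 Real.differentiable_arctan.differentiableAt
  have hS' : Tendsto (fun α => dslope Real.arctan 0
      (Real.tan (Real.pi * α / 2) * ((1 - g α) / (1 + g α)))) (𝓝[>] 0) (𝓝 1) := by
    have := hS.tendsto.comp hT0
    rw [dslope_same] at this
    simpa [Function.comp_def] using this
  have h := ((hS'.mul (hT.mul hw)).div_const Real.pi).const_sub (1 / 2)
  have hlim : 1 / 2 - 1 * (Real.pi / 2 * w₀) / Real.pi = u₀ / (1 + u₀) := by
    rw [hw₀]; field_simp; ring
  rw [hlim] at h
  refine h.congr' ?_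
  filter_upwards [self_mem_nhdsWithin] with α hα
  have hα : 0 < α := hα
  have key := sub_smul_dslope Real.arctan 0
    (Real.tan (Real.pi * α / 2) * ((1 - g α) / (1 + g α)))
  rw [Real.arctan_zero, sub_zero, sub_zero, smul_eq_mul] at key
  rw [lampertiCDF, ← key]
  field_simp

end

/-! ### Error probability of the minimum estimator. -/

theorem iIndepFun_rows {Ω ι κ : Type*} [Fintype ι] [Fintype κ] [MeasurableSpace Ω] {P : Measure Ω}
    {X : ι × κ → Ω → ℝ} (h : iIndepFun X P) (hm : ∀ p, AEMeasurable (X p) P) :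
    iIndepFun (fun (i : ι) ω (j : κ) => X (i, j) ω) P := by
  have := h.isProbabilityMeasure
  have hp : ∀ p, IsProbabilityMeasure (P.map (X p)) := fun p =>
    Measure.isProbabilityMeasure_map (hm p)
  have hrow : ∀ i : ι, iIndepFun (fun (j : κ) => X (i, j)) P := fun i =>
    h.precomp (g := fun j => (i, j)) (Prod.mk_right_injective i)
  have hmrow : ∀ i : ι, AEMeasurable (fun ω (j : κ) => X (i, j) ω) P := fun i =>
    aemeasurable_pi_lambda _ fun j => hm (i, j)
  have hmall : AEMeasurable (fun ω (p : ι × κ) => X p ω) P :=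
    aemeasurable_pi_lambda _ fun p => hm p
  rw [iIndepFun_iff_map_fun_eq_infinitePi_map₀ (aemeasurable_pi_lambda _ fun i => hmrow i)]
  have e1 := (iIndepFun_iff_map_fun_eq_infinitePi_map₀ hmall).1 h
  have e2 := Measure.infinitePi_map_curry (fun i j => P.map (X (i, j)))
  have e3 : P.map (fun ω (i : ι) (j : κ) => X (i, j) ω) =
      (P.map (fun ω (p : ι × κ) => X p ω)).map (MeasurableEquiv.curry ι κ ℝ) :=
    (AEMeasurable.map_map_of_aemeasurable
      (MeasurableEquiv.curry ι κ ℝ).measurable.aemeasurable hmall).symm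
  rw [e3, e1]
  refine e2.trans ?_
  congr 1
  funext i
  exact ((iIndepFun_iff_map_fun_eq_infinitePi_map₀ (hmrow i)).1 (hrow i)).symm

section
variable {α : ℝ} {μ : Measure ℝ} {Ω : Type*} [MeasurableSpace Ω] {P : Measure Ω}
  [IsProbabilityMeasure P] {N : ℕ}

theorem measureReal_linearCombination_nonneg (hμ : IsMaxSkewedStable α μ) (hα : 0 < α)
    {S : Fin N → Ω → ℝ} (hS : iIndepFun S P) (hlaw : ∀ k, HasLaw (S k) μ P) (c : Fin N → ℝ)
    (hc : 0 < ∑ k, |c k| ^ α) :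
    P.real {ω | 0 ≤ ∑ k, c k * S k ω} = 1 / 2 + Real.arctan (Real.tan (Real.pi * α / 2) *
      ((∑ k, Real.sign (c k) * |c k| ^ α) / ∑ k, |c k| ^ α)) / (Real.pi * α) := by
  have hm : ∀ k, AEMeasurable (fun ω => c k * S k ω) P := fun k =>
    (hlaw k).aemeasurable.const_mul (c k)
  have hmsum : AEMeasurable (fun ω => ∑ k, c k * S k ω) P := by fun_prop
  have hind : iIndepFun (fun k ω => c k * S k ω) P :=
    hS.comp (fun k x => c k * x) fun k => by fun_prop
  set ν := P.map (fun ω => ∑ k, c k * S k ω) with hν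
  have hνp : IsProbabilityMeasure ν := Measure.isProbabilityMeasure_map hmsum
  have hchar : ∀ u : ℝ, 0 < u → charFun ν u = Complex.exp (-((u ^ α : ℝ) : ℂ) *
      (((∑ k, |c k| ^ α : ℝ) : ℂ) - ((Real.tan (Real.pi * α / 2) *
        ∑ k, Real.sign (c k) * |c k| ^ α : ℝ) : ℂ) * Complex.I)) := by
    intro u hu
    rw [hν, hind.charFun_map_fun_sum_eq_prod hm, Finset.prod_apply]
    have : ∀ k, charFun (P.map fun ω => c k * S k ω) u =
        Complex.exp (-((u ^ α : ℝ) : ℂ) * (((|c k| ^ α : ℝ) : ℂ) -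
        ((Real.tan (Real.pi * α / 2) * (Real.sign (c k) * |c k| ^ α) : ℝ) : ℂ) *
          Complex.I)) := by
      intro k
      rw [charFun_map_mul_comp (hlaw k).aemeasurable, (hlaw k).map_eq, hμ.charFun_mul _ hu]
    simp_rw [this]
    rw [← Complex.exp_sum, ← Finset.mul_sum, Finset.sum_sub_distrib, ← Finset.sum_mul,
      Finset.mul_sum (f := fun k => Real.sign (c k) * |c k| ^ α)]
    push_cast
    rfl
  obtain ⟨-, h1⟩ := stable_measureReal_Iio hα hc hchar
  have h2 : P.real {ω | 0 ≤ ∑ k, c k * S k ω} = ν.real (Ici 0) := by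
    rw [hν, measureReal_def, measureReal_def,
      Measure.map_apply_of_aemeasurable hmsum measurableSet_Ici]
    rfl
  rw [h2, ← compl_Iio, probReal_compl_eq_one_sub measurableSet_Iio, h1, mul_div_assoc]
  ring

theorem sum_rpow_pos {x : Fin N → ℝ} (hx : ∀ i, 0 ≤ x i) (hx0 : x ≠ 0) :
    0 < ∑ i, x i ^ α := by
  obtain ⟨i, hi⟩ := Function.ne_iff.1 hx0
  exact Finset.sum_pos' (fun i _ => Real.rpow_nonneg (hx i) α)
    ⟨i, Finset.mem_univ i, Real.rpow_pos_of_pos (lt_of_le_of_ne (hx i) (Ne.symm hi)) α⟩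

/-- The exact probability involves `A`, the sum without `x i ^ α`. Since `(A - ε ^ α) / (A + ε ^ α)`
increases with `A`, passing to the full sum only enlarges it and makes the bound uniform in `i`. -/
theorem measureReal_single_error_le (hμ : IsMaxSkewedStable α μ) (hα : α ∈ Ioo (0 : ℝ) 1)
    {S : Fin N → Ω → ℝ} (hS : iIndepFun S P) (hlaw : ∀ k, HasLaw (S k) μ P) {x : Fin N → ℝ}
    (hx : ∀ i, 0 ≤ x i) (hx0 : x ≠ 0) {ε : ℝ} (hε : 0 < ε) (i : Fin N) :
    P.real {ω | 0 ≤ ∑ k, Function.update x i (-ε) k * S k ω} ≤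
      1 - lampertiCDF α (ε ^ α / ∑ k, x k ^ α) := by
  have hΘ : 0 < ∑ k, x k ^ α := sum_rpow_pos hx hx0
  have he : 0 < ε ^ α := Real.rpow_pos_of_pos hε α
  set A := ∑ k ∈ Finset.univ.erase i, x k ^ α with hA
  have hA0 : 0 ≤ A := Finset.sum_nonneg fun k _ => Real.rpow_nonneg (hx k) α
  have hAle : A ≤ ∑ k, x k ^ α :=
    Finset.sum_le_sum_of_subset_of_nonneg (Finset.erase_subset _ _)
      fun k _ _ => Real.rpow_nonneg (hx k) α
  have s1 : ∑ k, |Function.update x i (-ε) k| ^ α = ε ^ α + A := by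
    rw [← Finset.add_sum_erase _ _ (Finset.mem_univ i), Function.update_self, abs_neg,
      abs_of_pos hε]
    congr 1
    refine Finset.sum_congr rfl fun k hk => ?_
    rw [Function.update_of_ne (Finset.ne_of_mem_erase hk), abs_of_nonneg (hx k)]
  have s2 : ∑ k, Real.sign (Function.update x i (-ε) k) * |Function.update x i (-ε) k| ^ α =
      -ε ^ α + A := by
    rw [← Finset.add_sum_erase _ _ (Finset.mem_univ i), Function.update_self, abs_neg,
      abs_of_pos hε, Real.sign_of_neg (neg_neg_of_pos hε), neg_one_mul]
    congr 1
    refine Finset.sum_congr rfl fun k hk => ?_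
    rw [Function.update_of_ne (Finset.ne_of_mem_erase hk), abs_of_nonneg (hx k)]
    rcases (hx k).eq_or_lt with h | h
    · rw [← h, Real.zero_rpow hα.1.ne', mul_zero]
    · rw [Real.sign_of_pos h, one_mul]
  rw [measureReal_linearCombination_nonneg hμ hα.1 hS hlaw _ (by rw [s1]; positivity), s1, s2,
    lampertiCDF]
  set Θ := ∑ k, x k ^ α with hΘdef
  have hw : (-ε ^ α + A) / (ε ^ α + A) ≤ (1 - ε ^ α / Θ) / (1 + ε ^ α / Θ) := by
    have : (1 - ε ^ α / Θ) / (1 + ε ^ α / Θ) = (Θ - ε ^ α) / (Θ + ε ^ α) := by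
      field_simp
    rw [this, div_le_div_iff₀ (by positivity) (by positivity)]
    nlinarith
  have hβ : 0 < Real.pi * α := mul_pos Real.pi_pos hα.1
  have := div_le_div_of_nonneg_right (Real.arctan_mono
    (mul_le_mul_of_nonneg_left hw (tan_pi_mul_div_two_pos hα).le)) hβ.le
  linarith

theorem measureReal_minEstimator_error_le {M : ℕ} (hμ : IsMaxSkewedStable α μ)
    (hα : α ∈ Ioo (0 : ℝ) 1) {s : Fin N → Fin M → Ω → ℝ}
    (hs : iIndepFun (fun p : Fin N × Fin M => s p.1 p.2) P) (hlaw : ∀ i j, HasLaw (s i j) μ P)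
    {x : Fin N → ℝ} (hx : ∀ i, 0 ≤ x i) (hx0 : x ≠ 0) {ε : ℝ} (hε : 0 < ε) (i : Fin N) :
    P.real {ω | minEstimator x (fun i j => s i j ω) i - x i ≥ ε} ≤
      (1 - lampertiCDF α (ε ^ α / ∑ k, x k ^ α)) ^ M := by
  set Y : Fin M → Ω → ℝ := fun j ω => ∑ k, Function.update x i (-ε) k * s k j ω with hY
  have hcols : iIndepFun (fun (j : Fin M) ω (k : Fin N) => s k j ω) P :=
    iIndepFun_rows (X := fun p : Fin M × Fin N => s p.2 p.1)
      (hs.precomp (g := Prod.swap) Prod.swap_injective) fun p => (hlaw p.2 p.1).aemeasurable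
  have hYind : iIndepFun Y P :=
    hcols.comp (fun _ v => ∑ k, Function.update x i (-ε) k * v k) fun _ => by fun_prop
  have hcol : ∀ j, iIndepFun (fun k => s k j) P := fun j =>
    hs.precomp (g := fun k => (k, j)) (Prod.mk_left_injective j)
  have hpos : ∀ᵐ ω ∂P, ∀ j, 0 < s i j ω := by
    rw [ae_all_iff]
    intro j
    have := hμ.ae_pos hα
    rw [← (hlaw i j).map_eq] at this
    exact ae_of_ae_map (hlaw i j).aemeasurable this
  -- Multiplying by `s i j > 0` cancels the term `x i * s i j` and leaves coefficient `-ε` in place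
  -- `i`.
  have hsub : ({ω | minEstimator x (fun i j => s i j ω) i - x i ≥ ε} : Set Ω) ≤ᵐ[P]
      (⋂ j, Y j ⁻¹' Ici 0 : Set Ω) := by
    filter_upwards [hpos] with ω hω (h : minEstimator x (fun i j => s i j ω) i - x i ≥ ε)
    refine mem_iInter.2 fun j => ?_
    have h1 : minEstimator x (fun i j => s i j ω) i ≤
        measurement x (fun i j => s i j ω) j / s i j ω :=
      ciInf_le (Set.finite_range _).bddBelow j
    have h2 : x i + ε ≤ measurement x (fun i j => s i j ω) j / s i j ω := by linarith
    rw [le_div_iff₀ (hω j), measurement, ← Finset.add_sum_erase _ _ (Finset.mem_univ i)] at h2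
    change 0 ≤ ∑ k, Function.update x i (-ε) k * s k j ω
    rw [← Finset.add_sum_erase _ _ (Finset.mem_univ i), Function.update_self]
    have h3 : ∑ k ∈ Finset.univ.erase i, Function.update x i (-ε) k * s k j ω =
        ∑ k ∈ Finset.univ.erase i, x k * s k j ω :=
      Finset.sum_congr rfl fun k hk => by
        rw [Function.update_of_ne (Finset.ne_of_mem_erase hk)]
    rw [h3]
    linarith
  calc P.real {ω | minEstimator x (fun i j => s i j ω) i - x i ≥ ε}
      ≤ P.real (⋂ j, Y j ⁻¹' Ici 0) :=
        ENNReal.toReal_mono (measure_ne_top _ _) (measure_mono_ae hsub)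
    _ = ∏ j, P.real (Y j ⁻¹' Ici 0) := by
        rw [measureReal_def, hYind.meas_iInter fun j => ⟨Ici 0, measurableSet_Ici, rfl⟩,
          ENNReal.toReal_prod]
        rfl
    _ ≤ ∏ _j : Fin M, (1 - lampertiCDF α (ε ^ α / ∑ k, x k ^ α)) :=
        Finset.prod_le_prod (fun _ _ => measureReal_nonneg) fun j _ =>
          measureReal_single_error_le hμ hα (hcol j) (fun k => hlaw k j) hx hx0 hε i
    _ = _ := by simp

theorem sum_measureReal_minEstimator_error_le {M : ℕ} (hμ : IsMaxSkewedStable α μ)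
    (hα : α ∈ Ioo (0 : ℝ) 1) {s : Fin N → Fin M → Ω → ℝ}
    (hs : iIndepFun (fun p : Fin N × Fin M => s p.1 p.2) P) (hlaw : ∀ i j, HasLaw (s i j) μ P)
    {x : Fin N → ℝ} (hx : ∀ i, 0 ≤ x i) (hx0 : x ≠ 0) {ε δ κ : ℝ} (hε : 0 < ε) (hδ : 0 < δ)
    (hκ : 1 - lampertiCDF α (ε ^ α / ∑ k, x k ^ α) ≤ Real.exp (-κ))
    (hM : Real.log (N / δ) ≤ M * κ) :
    ∑ i, P.real {ω | minEstimator x (fun i j => s i j ω) i - x i ≥ ε} ≤ δ := by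
  have hΘ : 0 < ∑ k, x k ^ α := sum_rpow_pos hx hx0
  have he : 0 < ε ^ α := Real.rpow_pos_of_pos hε α
  have hF := lampertiCDF_lt_one hα (div_pos he hΘ).le
  have hN : 0 < (N : ℝ) := by
    obtain ⟨i, -⟩ := Function.ne_iff.1 hx0
    exact_mod_cast i.pos
  calc ∑ i, P.real {ω | minEstimator x (fun i j => s i j ω) i - x i ≥ ε}
      ≤ ∑ _i : Fin N, Real.exp (-κ) ^ M :=
        Finset.sum_le_sum fun i _ => (measureReal_minEstimator_error_le hμ hα hs hlaw hx hx0 hε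
          i).trans (pow_le_pow_left₀ (by linarith) hκ M)
    _ = N * Real.exp (-(M * κ)) := by
        rw [Finset.sum_const, Finset.card_univ, Fintype.card_fin, nsmul_eq_mul,
          ← Real.exp_nat_mul, mul_neg]
    _ ≤ N * Real.exp (-Real.log (N / δ)) :=
        mul_le_mul_of_nonneg_left (Real.exp_le_exp.2 (neg_le_neg hM)) hN.le
    _ = δ := by
        rw [Real.exp_neg, Real.exp_log (div_pos hN hδ)]
        field_simp

theorem div_signalScale_rpow {x : Fin N → ℝ} (hα : 0 < α) (hx : ∀ i, 0 ≤ x i) (hx0 : x ≠ 0)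
    {ε : ℝ} (hε : 0 < ε) : 0 < signalScale α x ∧
      (ε / signalScale α x) ^ α = ε ^ α / ∑ k, x k ^ α := by
  have hΘ : 0 < ∑ k, x k ^ α := sum_rpow_pos hx hx0
  have h0 : 0 < signalScale α x := Real.rpow_pos_of_pos hΘ _
  refine ⟨h0, ?_⟩
  rw [Real.div_rpow hε.le h0.le, signalScale, ← Real.rpow_mul hΘ.le,
    one_div_mul_cancel hα.ne', Real.rpow_one]

end

/-! ### Transfer to `F_α` and the sufficient conditions. -/

theorem rpow_div_one_sub_rpow {α r : ℝ} (hα : α ∈ Ioo (0 : ℝ) 1) (hr : 0 < r) :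
    (r ^ (α / (1 - α))) ^ (1 - α) = r ^ α := by
  rw [← Real.rpow_mul hr.le, div_mul_cancel₀ _ (by linarith [hα.2])]

theorem ratioCDF_rpow_eq_lampertiCDF {α r : ℝ} {μ : Measure ℝ} (hμ : IsMaxSkewedStable α μ)
    (hα : α ∈ Ioo (0 : ℝ) 1) (hr : 0 < r) :
    ratioCDF α μ (r ^ (α / (1 - α))) = lampertiCDF α (r ^ α) := by
  rw [ratioCDF_eq_lampertiCDF hμ hα (Real.rpow_pos_of_pos hr _), rpow_div_one_sub_rpow hα hr]

theorem tendsto_rpow_div_ratioCDF {α : ℝ} {μ : Measure ℝ} (hμ : IsMaxSkewedStable α μ)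
    (hα : α ∈ Ioo (0 : ℝ) 1) :
    Tendsto (fun t : ℝ => t ^ (1 - α) / ratioCDF α μ t) (𝓝[>] 0)
      (𝓝 (Real.pi * α / Real.sin (Real.pi * α))) := by
  refine ((tendsto_div_lampertiCDF hα).comp
    (tendsto_rpow_nhdsGT_zero (p := 1 - α) (by linarith [hα.2]))).congr' ?_
  filter_upwards [self_mem_nhdsWithin] with t ht
  rw [ratioCDF_eq_lampertiCDF hμ hα ht]
  rfl

theorem tendsto_rpow_div_log_one_sub_ratioCDF {α : ℝ} {μ : Measure ℝ}
    (hμ : IsMaxSkewedStable α μ) (hα : α ∈ Ioo (0 : ℝ) 1) :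
    Tendsto (fun r : ℝ => (Real.pi * α / Real.sin (Real.pi * α) * (1 / r) ^ α) /
      (1 / (-Real.log (1 - ratioCDF α μ (r ^ (α / (1 - α))))))) (𝓝[>] 0) (𝓝 1) := by
  have hβ : 0 < Real.pi * α := mul_pos Real.pi_pos hα.1
  have h := ((tendsto_neg_log_one_sub_lampertiCDF_div hα).comp
    (tendsto_rpow_nhdsGT_zero hα.1)).const_mul (Real.pi * α / Real.sin (Real.pi * α))
  have hsin := sin_pi_mul_pos hα
  rw [div_mul_div_cancel₀ hsin.ne', div_self hβ.ne'] at h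
  refine h.congr' ?_
  filter_upwards [self_mem_nhdsWithin] with r hr
  have hr : 0 < r := hr
  rw [ratioCDF_rpow_eq_lampertiCDF hμ hα hr, Real.div_rpow zero_le_one hr.le, Real.one_rpow]
  simp only [Function.comp_apply, div_eq_mul_inv, one_mul, inv_inv]
  ring

theorem tendsto_log_one_add_div_log_one_sub_ratioCDF {μ : ℝ → Measure ℝ}
    (hμ : ∀ α ∈ Ioo (0 : ℝ) 1, IsMaxSkewedStable α (μ α)) {N : ℕ} {x : Fin N → ℝ}
    (hx : ∀ i, 0 ≤ x i) (hx0 : x ≠ 0) {ε : ℝ} (hε : 0 < ε) :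
    Tendsto (fun α : ℝ =>
      (1 / Real.log (1 + (ε / signalScale α x) ^ (α / (1 - α)))) /
      (1 / (-Real.log (1 - ratioCDF α (μ α) ((ε / signalScale α x) ^ (α / (1 - α)))))))
      (𝓝[>] 0) (𝓝 1) := by
  have hrpow : ∀ y : ℝ, y ≠ 0 → Tendsto (fun α : ℝ => y ^ α) (𝓝[>] 0) (𝓝 1) := by
    intro y hy
    have := (Real.continuousAt_const_rpow (b := 0) hy).tendsto
    rw [Real.rpow_zero] at this
    exact this.mono_left nhdsWithin_le_nhds
  -- `K` counts the nonzero entries: `x k ^ α` tends to `1` if `x k ≠ 0` and is `0` otherwise. Both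
  -- logarithms below tend to `log (1 + 1 / K)`.
  set K : ℝ := ∑ k, if x k = 0 then 0 else 1 with hK
  have hK0 : 0 < K := by
    obtain ⟨i, hi⟩ := Function.ne_iff.1 hx0
    have hi : x i ≠ 0 := hi
    refine Finset.sum_pos' (fun k _ => ?_) ⟨i, Finset.mem_univ i, ?_⟩
    · split_ifs <;> norm_num
    · rw [if_neg hi]; norm_num
  have hsum : Tendsto (fun α : ℝ => ∑ k, x k ^ α) (𝓝[>] 0) (𝓝 K) := by
    refine tendsto_finsetSum _ fun k _ => ?_
    split_ifs with h
    · refine tendsto_const_nhds.congr' ?_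
      filter_upwards [self_mem_nhdsWithin] with α hα
      rw [h, Real.zero_rpow (ne_of_gt hα)]
    · exact hrpow _ h
  set u₀ := 1 / K with hu₀
  have hu₀pos : 0 < u₀ := by positivity
  have hg : Tendsto (fun α : ℝ => ε ^ α / ∑ k, x k ^ α) (𝓝[>] 0) (𝓝 u₀) :=
    (hrpow ε hε.ne').div hsum hK0.ne'
  have hid : Tendsto (fun α : ℝ => α) (𝓝[>] 0) (𝓝 0) := tendsto_id.mono_left nhdsWithin_le_nhds
  have hexp : Tendsto (fun α : ℝ => 1 / (1 - α)) (𝓝[>] 0) (𝓝 1) := by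
    simpa using (hid.const_sub 1).inv₀ (by norm_num)
  have ht : Tendsto (fun α : ℝ => (ε ^ α / ∑ k, x k ^ α) ^ (1 / (1 - α))) (𝓝[>] 0) (𝓝 u₀) := by
    simpa using hg.rpow hexp (Or.inl hu₀pos.ne')
  have hlog : 0 < Real.log (1 + u₀) := Real.log_pos (by linarith)
  have h1 : Tendsto (fun α : ℝ => Real.log (1 + (ε ^ α / ∑ k, x k ^ α) ^ (1 / (1 - α))))
      (𝓝[>] 0) (𝓝 (Real.log (1 + u₀))) :=
    (ht.const_add 1).log (by linarith)
  have h2 : Tendsto (fun α : ℝ => -Real.log (1 - lampertiCDF α (ε ^ α / ∑ k, x k ^ α)))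
      (𝓝[>] 0) (𝓝 (Real.log (1 + u₀))) := by
    have e : (1 : ℝ) - u₀ / (1 + u₀) = (1 + u₀)⁻¹ := by field_simp; ring
    have := (((tendsto_lampertiCDF_nhdsGT_zero hu₀pos hg).const_sub 1).log
      (by rw [e]; positivity)).neg
    rwa [e, Real.log_inv, neg_neg] at this
  have h := h2.div h1 hlog.ne'
  rw [div_self hlog.ne'] at h
  refine h.congr' ?_
  filter_upwards [Ioo_mem_nhdsGT (zero_lt_one (α := ℝ))] with α hα
  obtain ⟨hθ, hr⟩ := div_signalScale_rpow hα.1 hx hx0 hε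
  rw [ratioCDF_rpow_eq_lampertiCDF (hμ α hα) hα (div_pos hε hθ), hr,
    show α / (1 - α) = α * (1 / (1 - α)) by ring, Real.rpow_mul (div_pos hε hθ).le, hr]
  simp only [Pi.div_apply, div_eq_mul_inv, one_mul, inv_inv]
  ring

theorem theorem1 :
    ∃ (C : ℝ → ℝ) (η : ℝ → ℝ → ℝ),
      -- the constant `C α` and the `o(1)` term `η α r`, where `r = ε / θ → 0` for fixed `α`
      (∀ α ∈ Ioc (0 : ℝ) (1 / 2), 0 < C α ∧ Tendsto (η α) (𝓝[>] 0) (𝓝 0)) ∧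
      C (1 / 2) = Real.pi / 2 ∧
      Tendsto C (𝓝[>] 0) (𝓝 1) ∧
      -- `C α` is the constant in `F_α(t) = t^(1-α) / (C α + o(1))`, `t → 0`, and the third bound
      -- below is sharp: it is asymptotically equivalent to the first one
      (∀ α ∈ Ioc (0 : ℝ) (1 / 2), ∀ μ : Measure ℝ, IsMaxSkewedStable α μ →
        Tendsto (fun t : ℝ => t ^ (1 - α) / ratioCDF α μ t) (𝓝[>] 0) (𝓝 (C α)) ∧
        Tendsto (fun r : ℝ =>
            (C α * (1 / r) ^ α) / (1 / (-Real.log (1 - ratioCDF α μ (r ^ (α / (1 - α)))))))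
          (𝓝[>] 0) (𝓝 1)) ∧
      -- the second bound below is sharp as `α → 0`: for a fixed signal and a fixed precision it is
      -- asymptotically equivalent to the first one
      (∀ μ : ℝ → Measure ℝ, (∀ α ∈ Ioo (0 : ℝ) 1, IsMaxSkewedStable α (μ α)) →
        ∀ (N : ℕ) (x : Fin N → ℝ), (∀ i, 0 ≤ x i) → x ≠ 0 → ∀ ε : ℝ, 0 < ε →
          Tendsto (fun α : ℝ =>
              (1 / Real.log (1 + (ε / signalScale α x) ^ (α / (1 - α)))) /
              (1 / (-Real.log (1 - ratioCDF α (μ α) ((ε / signalScale α x) ^ (α / (1 - α)))))))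
            (𝓝[>] 0) (𝓝 1)) ∧
      -- the four sufficient conditions on the number `M` of measurements
      ∀ α ∈ Ioo (0 : ℝ) 1, ∀ μ : Measure ℝ, IsMaxSkewedStable α μ →
        ∀ (N M : ℕ), 0 < M →
        ∀ x : Fin N → ℝ, (∀ i, 0 ≤ x i) → x ≠ 0 →
        ∀ ε δ : ℝ, 0 < ε → 0 < δ →
        ∀ (Ω : Type*) [MeasurableSpace Ω] (P : Measure Ω) [IsProbabilityMeasure P]
          (s : Fin N → Fin M → Ω → ℝ),
          iIndepFun (fun p : Fin N × Fin M => s p.1 p.2) P →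
          (∀ i j, HasLaw (s i j) μ P) →
          ((M : ℝ) ≥ Real.log (N / δ) /
              (-Real.log (1 - ratioCDF α μ ((ε / signalScale α x) ^ (α / (1 - α))))) →
            ∑ i, P.real {ω | minEstimator x (fun i j => s i j ω) i - x i ≥ ε} ≤ δ) ∧
          (ε / signalScale α x < 1 →
            (M : ℝ) ≥ Real.log (N / δ) /
              Real.log (1 + (ε / signalScale α x) ^ (α / (1 - α))) →
            ∑ i, P.real {ω | minEstimator x (fun i j => s i j ω) i - x i ≥ ε} ≤ δ) ∧
          (α ≤ 1 / 2 → ε / signalScale α x < α →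
            (M : ℝ) ≥ (C α + η α (ε / signalScale α x)) * (signalScale α x / ε) ^ α *
              Real.log (N / δ) →
            ∑ i, P.real {ω | minEstimator x (fun i j => s i j ω) i - x i ≥ ε} ≤ δ) ∧
          (α = 1 / 2 → ε / signalScale α x < 1 →
            (M : ℝ) ≥ Real.pi / 2 * Real.sqrt (signalScale α x / ε) * Real.log (N / δ) →
            ∑ i, P.real {ω | minEstimator x (fun i j => s i j ω) i - x i ≥ ε} ≤ δ) := by
  have hsub : ∀ α ∈ Ioc (0 : ℝ) (1 / 2), α ∈ Ioo (0 : ℝ) 1 := fun α hα =>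
    ⟨hα.1, by linarith [hα.2]⟩
  -- The bound `L(u) ≥ u / (C α (1 + u))` at `u = r ^ α` asks for `M ≥ C α (1 + r ^ α) r ^ (-α) log
  -- (N / δ)`, hence `η α r = C α * r ^ α`.
  refine ⟨fun α => Real.pi * α / Real.sin (Real.pi * α),
    fun α r => Real.pi * α / Real.sin (Real.pi * α) * r ^ α, ?_, ?_, tendsto_mul_div_sin_zero,
    ?_, ?_, ?_⟩
  · intro α hα
    refine ⟨div_pos (mul_pos Real.pi_pos hα.1) (sin_pi_mul_pos (hsub α hα)), ?_⟩
    simpa using ((tendsto_rpow_nhdsGT_zero hα.1).mono_right nhdsWithin_le_nhds).const_mul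
      (Real.pi * α / Real.sin (Real.pi * α))
  · simp only [show Real.pi * (1 / 2) = Real.pi / 2 by ring, Real.sin_pi_div_two, div_one]
  · exact fun α hα μ hμ => ⟨tendsto_rpow_div_ratioCDF hμ (hsub α hα),
      tendsto_rpow_div_log_one_sub_ratioCDF hμ (hsub α hα)⟩
  · exact fun μ hμ N x hx hx0 ε hε =>
      tendsto_log_one_add_div_log_one_sub_ratioCDF hμ hx hx0 hε
  intro α hα μ hμ N M _ x hx hx0 ε δ hε hδ Ω _ P _ s hs hlaw
  obtain ⟨hθ, hr⟩ := div_signalScale_rpow hα.1 hx hx0 hε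
  set r := ε / signalScale α x with hrdef
  have hr0 : 0 < r := div_pos hε hθ
  have hinv : signalScale α x / ε = r⁻¹ := by rw [hrdef, inv_div]
  have hu0 : 0 < r ^ α := Real.rpow_pos_of_pos hr0 α
  have hlt := lampertiCDF_lt_one hα hu0.le
  have hpos := lampertiCDF_pos hα hu0
  have main : ∀ κ : ℝ, 1 - lampertiCDF α (r ^ α) ≤ Real.exp (-κ) →
      Real.log (N / δ) ≤ M * κ →
      ∑ i, P.real {ω | minEstimator x (fun i j => s i j ω) i - x i ≥ ε} ≤ δ := fun κ hκ hM =>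
    sum_measureReal_minEstimator_error_le hμ hα hs hlaw hx hx0 hε hδ (hr ▸ hκ) hM
  refine ⟨fun hM => ?_, fun hr1 hM => ?_, fun _ _ hM => ?_, fun hα2 hr1 hM => ?_⟩
  · rw [ratioCDF_rpow_eq_lampertiCDF hμ hα hr0, ge_iff_le, div_le_iff₀
      (neg_pos.2 (Real.log_neg (by linarith) (by linarith)))] at hM
    exact main _ (by rw [neg_neg, Real.exp_log (by linarith)]) hM
  · have ht0 : 0 < r ^ (α / (1 - α)) := Real.rpow_pos_of_pos hr0 _
    have ht1 : r ^ (α / (1 - α)) ≤ 1 :=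
      Real.rpow_le_one hr0.le hr1.le (div_nonneg hα.1.le (by linarith [hα.2]))
    rw [ge_iff_le, div_le_iff₀ (Real.log_pos (by linarith))] at hM
    refine main _ ?_ hM
    have h := div_one_add_le_lampertiCDF hα ht0 ht1
    rw [rpow_div_one_sub_rpow hα hr0] at h
    rw [Real.exp_neg, Real.exp_log (by linarith)]
    have e : r ^ (α / (1 - α)) / (1 + r ^ (α / (1 - α))) =
        1 - (1 + r ^ (α / (1 - α)))⁻¹ := by field_simp; ring
    linarith
  · have hsin := sin_pi_mul_pos hα
    have hβ : 0 < Real.pi * α := mul_pos Real.pi_pos hα.1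
    have h := le_lampertiCDF hα hu0.le
    -- Here `κ` is the lower bound for `L(r ^ α)` itself, by `1 - κ ≤ exp (-κ)`.
    refine main (Real.sin (Real.pi * α) / (Real.pi * α) * (r ^ α / (1 + r ^ α))) ?_ ?_
    · exact (by linarith : _ ≤ -(Real.sin (Real.pi * α) / (Real.pi * α) *
        (r ^ α / (1 + r ^ α))) + 1).trans (Real.add_one_le_exp _)
    · have hκ : 0 < Real.sin (Real.pi * α) / (Real.pi * α) * (r ^ α / (1 + r ^ α)) := by
        positivity
      rw [← div_le_iff₀ hκ]
      refine le_of_eq_of_le ?_ hM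
      rw [hinv, Real.inv_rpow hr0.le]
      field_simp
  · have hu1 : r ^ α ≤ 1 := Real.rpow_le_one hr0.le hr1.le hα.1.le
    subst hα2
    have hpi := Real.pi_pos
    refine main (2 / Real.pi * r ^ (1 / 2 : ℝ)) (one_sub_lampertiCDF_half_le hu0.le hu1) ?_
    rw [← div_le_iff₀ (by positivity)]
    refine le_of_eq_of_le ?_ hM
    rw [hinv, Real.sqrt_inv, Real.sqrt_eq_rpow]
    field_simp
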